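/- For real polynomials $p(x)=\sum_{i=0}^{n}x^{n-i}(-1)^i a_i$ and $q(x)=\sum_{i=0}^{n}x^{n-i}(-1)^i b_i$ and an integer $m\ge n$, let $$(p\boxplus_{m,n}q)(x)=\sum_{\ell=0}^{n}x^{n-\ell}(-1)^\ell\sum_{i+j=\ell}\frac{(n-i)!\,(n-j)!}{n!\,(n-\ell)!}\,\frac{(m-i)!\,(m-j)!}{m!\,(m-\ell)!}\,a_i b_j ,$$ and let $(\mathbb S p)(x)=p(x^2)$. For a real number $\theta\ge 0$ and integers $d\ge 1$ and $m\ge n\ge 1$ put $$q_d^{[\theta,m,n]}=\mathbb S\bigl(\underbrace{(x-\theta)^n\boxplus_{m,n}\cdots\boxplus_{m,n}(x-\theta)^n}_{d\text{ factors}}\bigr),$$ where the iterated convolution is evaluated from left to right. **Proposition 3.1.** For all real $u,\theta\ge 0$ and all integers $d\ge 1$ and $m\ge n\ge 1$, the polynomial $q_d^{[\theta,m,n]}$ is nonzero and has only real roots, and its largest root $\lambda_1\bigl(q_d^{[\theta,m,n]}\bigr)$ satisfies $$\lambda_1\bigl(q_d^{[\theta,m,n]}\bigr)^2\;\le\;\Bigl(d\sqrt{\theta+m^2u^2}-dmu+(m+n)u\Bigr)^2-(m-n)^2u^2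 .$$ -/

import Mathlib

open Polynomial

/-- The `i`-th signed coefficient `a_i` of a polynomial written as
`p(x) = ∑_{i=0}^{n} x^(n-i) (-1)^i a_i`. -/
noncomputable def signedCoeff (n : ℕ) (p : ℝ[X]) (i : ℕ) : ℝ :=
  (-1) ^ i * p.coeff (n - i)

/-- The rectangular additive convolution `p ⊞_{m,n} q` of polynomials of degree `n`, for `m ≥ n`. -/
noncomputable def rectConv (m n : ℕ) (p q : ℝ[X]) : ℝ[X] :=
  ∑ l ∈ Finset.range (n + 1),
    C ((-1) ^ l * ∑ ij ∈ Finset.HasAntidiagonal.antidiagonal l,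
      (((n - ij.1).factorial : ℝ) * ((n - ij.2).factorial : ℝ)) /
          ((n.factorial : ℝ) * ((n - l).factorial : ℝ)) *
        ((((m - ij.1).factorial : ℝ) * ((m - ij.2).factorial : ℝ)) /
          ((m.factorial : ℝ) * ((m - l).factorial : ℝ))) *
        signedCoeff n p ij.1 * signedCoeff n q ij.2) * X ^ (n - l)

/-- The convolution `p ⊞_{m,n} p ⊞_{m,n} ⋯ ⊞_{m,n} p` with `d ≥ 1` factors.
The value at `d = 0` is the neutral element `x^n` of the convolution. -/
noncomputable def rectConvPow (m n : ℕ) (p : ℝ[X]) : ℕ → ℝ[X]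
  | 0 => X ^ n
  | 1 => p
  | d + 2 => rectConv m n (rectConvPow m n p (d + 1)) p

/-- The operator `S` on polynomials, `(S p)(x) = p(x^2)`. -/
noncomputable def squareSubst (p : ℝ[X]) : ℝ[X] := p.comp (X ^ 2)

/-- The polynomial `q_d = S((x-θ)^n ⊞_{m,n} ⋯ ⊞_{m,n} (x-θ)^n)` with `d` factors. -/
noncomputable def qPoly (θ : ℝ) (m n d : ℕ) : ℝ[X] :=
  squareSubst (rectConvPow m n ((X - C θ) ^ n) d)

/-- `lam` is the largest root `λ₁(q)` of the real-rooted polynomial `q`: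
`q` is a nonzero polynomial with only real roots, and `lam` is the greatest of them. -/
def IsLargestRoot (q : ℝ[X]) (lam : ℝ) : Prop :=
  q ≠ 0 ∧ q.Splits ∧ IsGreatest {x : ℝ | q.IsRoot x} lam

/-!
Let `m = n + κ` and `α = 2 u`. In suitable normalisation the convolution lets `p` act on `q` as a
polynomial in the operator `M = x D² + (κ + 1) D` (`besselOp`), see `rectConv_eq_besselConv`. The
proof combines a barrier argument, which bounds the roots, with a proof of real-rootedness.

*Barrier.* A point `x > 0` is paired with `y = x + κ α`, and `p` is studied through the functional
`p(t) - b p'(t)` at `t = x y` with `b = α y` (`barrier`). A multiset of roots in `[0, t)` is below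
the barrier at `x` (`IsBelow`) if this functional is nonnegative at its monic polynomial. If the
roots of `p` and `q`, of degree `n`, are below the barrier at `x₁` and at `x₂`, then the functional
at `x₁ + x₂ - n α` is nonnegative at the convolution (`barrier_besselConv`). The proof is an
induction on `n`. The functional is linear in each of `p` and `q`, and a smoothing principle
(`nonneg_of_isBelow`) pinches the roots of a polynomial together while the logarithmic derivative at
`t` stays fixed. Every pinching step loses a nonnegative multiple of a polynomial of smaller degree
that is still below the barrier. Convolution with a polynomial of smaller degree is a convolution in
smaller degree after one application of `M`, which moves the barrier from `x` to `x - α`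
(`exists_isBelow_besselOp`). This leaves the case of two pure powers, whose convolution is a
translated Gegenbauer polynomial (`besselConv_pow_pow`); there the inequality follows from bounds
on ratios of consecutive Gegenbauer polynomials (`gegen_ratio`, `gegen_barrier`). All hypotheses
survive a simultaneous dilation of `x₁`, `x₂` and `α`, and nonnegativity of the functional at all
dilates puts the roots of the convolution below `t` (`lt_of_barrier_nonneg`).

*Real-rootedness.* For `p` with nonnegative roots, the polynomial `y^κ p(x y)` in two variables has
no zeros in the product of two upper half planes. Laguerre's theorem on polar derivatives
(`polarDerivative_ne_zero`) and a lemma on bi-affine polynomials (`biaffine_sub_ne_zero`) show that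
this is preserved by a degree lowering operator, whose iteration ends with the value at `z²` of the
convolution of `p` with `(x - θ)^n`, times `z^κ`. Hence this convolution has no complex roots
outside `[0, ∞)` (`exists_rectConv_pow_eq_rootPoly`).

*Conclusion.* Let `δ = √(θ + m² u²) - m u`, so that `θ = δ (δ + m α)`. For `u > 0` the roots of
`(x - θ)^n` are below the barrier at `n α + δ`, with equality, and therefore those of the `d`-fold
convolution at `n α + d δ`. The corresponding `t = (n α + d δ) (m α + d δ)` is the asserted bound
for the largest root, which is the square of the largest root after the substitution `x ↦ x²`. The
case `u = 0` follows by continuity.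
-/

/-! ### Barriers and the smoothing principle -/

/-- The monic polynomial with multiset of roots `s`. -/
noncomputable def rootPoly (s : Multiset ℝ) : ℝ[X] :=
  (s.map fun r => X - C r).prod

/-- The barrier functional `p ↦ p(t) - b p'(t)`. -/
noncomputable def barrier (t b : ℝ) : ℝ[X] →ₗ[ℝ] ℝ :=
  leval t - b • (leval t ∘ₗ derivative)

/-- All elements of the multiset `s` lie in `[0, t)`, and the logarithmic derivative at `t` of the
monic polynomial with these roots is at most `1 / b`. -/
structure IsBelow (s : Multiset ℝ) (t b : ℝ) : Prop where
  nonneg : ∀ r ∈ s, 0 ≤ r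
  lt : ∀ r ∈ s, r < t
  sum_le : b * (s.map fun r => (t - r)⁻¹).sum ≤ 1

theorem barrier_apply (t b : ℝ) (p : ℝ[X]) :
    barrier t b p = p.eval t - b * p.derivative.eval t := by
  simp [barrier, leval_apply]

@[simp] theorem rootPoly_cons (a : ℝ) (s : Multiset ℝ) :
    rootPoly (a ::ₘ s) = (X - C a) * rootPoly s := by
  simp [rootPoly]

theorem rootPoly_replicate (n : ℕ) (a : ℝ) :
    rootPoly (Multiset.replicate n a) = (X - C a) ^ n := by
  simp [rootPoly]

theorem rootPoly_monic (s : Multiset ℝ) : (rootPoly s).Monic :=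
  monic_multiset_prod_of_monic _ _ fun r _ => monic_X_sub_C r

theorem rootPoly_natDegree (s : Multiset ℝ) : (rootPoly s).natDegree = s.card :=
  natDegree_multiset_prod_X_sub_C_eq_card s

theorem rootPoly_roots (s : Multiset ℝ) : (rootPoly s).roots = s :=
  roots_multiset_prod_X_sub_C s

theorem rootPoly_splits (s : Multiset ℝ) : (rootPoly s).Splits := by
  rw [splits_iff_card_roots, rootPoly_roots, rootPoly_natDegree]

theorem rootPoly_eval (s : Multiset ℝ) (x : ℝ) :
    (rootPoly s).eval x = (s.map fun r => x - r).prod := by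
  simp [rootPoly, eval_multiset_prod, Multiset.map_map]

theorem rootPoly_eval_pos {s : Multiset ℝ} {x : ℝ} (h : ∀ r ∈ s, r < x) :
    0 < (rootPoly s).eval x := by
  rw [rootPoly_eval]
  apply Multiset.prod_pos
  intro y hy
  obtain ⟨r, hr, rfl⟩ := Multiset.mem_map.1 hy
  exact sub_pos.2 (h r hr)

theorem barrier_rootPoly {s : Multiset ℝ} {t : ℝ} (b : ℝ) (h : ∀ r ∈ s, r < t) :
    barrier t b (rootPoly s) =
      (rootPoly s).eval t * (1 - b * (s.map fun r => (t - r)⁻¹).sum) := by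
  have := (rootPoly_splits s).eval_derivative_eq_eval_mul_sum (rootPoly_eval_pos h).ne'
  rw [barrier_apply, this, rootPoly_roots]
  simp only [one_div]
  ring

theorem isBelow_of_barrier_nonneg {s : Multiset ℝ} {t b : ℝ} (h0 : ∀ r ∈ s, 0 ≤ r)
    (h : ∀ r ∈ s, r < t) (hb : 0 ≤ barrier t b (rootPoly s)) : IsBelow s t b := by
  refine ⟨h0, h, ?_⟩
  rw [barrier_rootPoly b h] at hb
  exact sub_nonneg.1 (nonneg_of_mul_nonneg_right hb (rootPoly_eval_pos h))

/-- Dilating the evaluation point by `τ ≥ 1`, together with the width `b`, keeps `IsBelow`. -/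
theorem IsBelow.dilate {s : Multiset ℝ} {t b : ℝ} (hs : IsBelow s t b) (ht : 0 ≤ t) (hb : 0 ≤ b)
    {τ : ℝ} (hτ : 1 ≤ τ) : IsBelow s (τ * t) (τ * b) := by
  have h0 : 0 < τ := by linarith
  refine ⟨hs.nonneg, fun r hr => (hs.lt r hr).trans_le (le_mul_of_one_le_left ht hτ), ?_⟩
  refine le_trans ?_ hs.sum_le
  rw [mul_comm τ b, mul_assoc, ← Multiset.sum_map_mul_left]
  refine mul_le_mul_of_nonneg_left (Multiset.sum_map_le_sum_map _ _ fun r hr => ?_) hb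
  have h1 := hs.lt r hr
  have h2 := hs.nonneg r hr
  have h3 : 0 < τ * t - r := by nlinarith
  rw [← div_eq_mul_inv, div_le_iff₀ h3, inv_mul_eq_div, le_div_iff₀ (by linarith)]
  nlinarith

/-- A multiset with sum zero and a positive element has a negative element. -/
theorem exists_neg_of_sum_eq_zero {s : Multiset ℝ} {f : ℝ → ℝ} (h : (s.map f).sum = 0)
    {r : ℝ} (hr : r ∈ s) (hf : 0 < f r) : ∃ q ∈ s, f q < 0 := by
  by_contra! hc
  have hm : f r ≤ (s.map f).sum := by
    refine Multiset.single_le_sum ?_ _ (Multiset.mem_map_of_mem f hr)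
    intro x hx
    obtain ⟨q, hq, rfl⟩ := Multiset.mem_map.1 hx
    exact hc q hq
  linarith

/-- Pinching: if the reciprocal gaps `(t - r₁)⁻¹ < m < (t - r₂)⁻¹` are replaced by `m` and
`(t - r₁)⁻¹ + (t - r₂)⁻¹ - m`, the quadratic with roots `r₁`, `r₂` loses a nonnegative multiple of
the linear polynomial whose reciprocal gap is the sum of the two. -/
theorem pinch_quadratic {t r₁ r₂ m : ℝ} (h₁ : r₁ < t) (h₂ : r₂ < t)
    (hm₁ : (t - r₁)⁻¹ < m) (hm₂ : m < (t - r₂)⁻¹) :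
    ∃ c : ℝ, 0 ≤ c ∧ (X - C r₁) * (X - C r₂) =
      (X - C (t - m⁻¹)) * (X - C (t - ((t - r₁)⁻¹ + (t - r₂)⁻¹ - m)⁻¹)) +
        C c * (X - C (t - ((t - r₁)⁻¹ + (t - r₂)⁻¹)⁻¹)) := by
  obtain ⟨a, ha⟩ : ∃ a, a = (t - r₁)⁻¹ := ⟨_, rfl⟩
  obtain ⟨e, he⟩ : ∃ e, e = (t - r₂)⁻¹ := ⟨_, rfl⟩
  have ha0 : 0 < a := ha ▸ inv_pos.2 (by linarith)
  have he0 : 0 < e := he ▸ inv_pos.2 (by linarith)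
  have hr₁ : r₁ = t - a⁻¹ := by rw [ha, inv_inv]; ring
  have hr₂ : r₂ = t - e⁻¹ := by rw [he, inv_inv]; ring
  rw [← ha] at hm₁ ⊢
  rw [← he] at hm₂ ⊢
  have hm0 : 0 < m := ha0.trans hm₁
  have hk : 0 < a + e - m := by linarith
  have hae : 0 < a + e := by linarith
  refine ⟨(a + e) * ((a * e)⁻¹ - (m * (a + e - m))⁻¹), ?_, ?_⟩
  · refine mul_nonneg hae.le (sub_nonneg.2 (inv_anti₀ (by positivity) ?_))
    nlinarith
  · subst hr₁ hr₂
    have h1 : (a + e) * ((a * e)⁻¹ - (m * (a + e - m))⁻¹) =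
        a⁻¹ + e⁻¹ - m⁻¹ - (a + e - m)⁻¹ := by
      field_simp
      ring
    have h2 : (a + e) * ((a * e)⁻¹ - (m * (a + e - m))⁻¹) * (a + e)⁻¹ =
        a⁻¹ * e⁻¹ - m⁻¹ * (a + e - m)⁻¹ := by
      field_simp
    have h3 : a⁻¹ * e⁻¹ = m⁻¹ * (a + e - m)⁻¹ +
        (a⁻¹ + e⁻¹ - m⁻¹ - (a + e - m)⁻¹) * (a + e)⁻¹ := by
      rw [← h1, h2]; ring
    rw [h1]
    simp only [C_sub, C_add]
    have h4 := congrArg (C : ℝ →+* ℝ[X]) h3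
    simp only [C_mul, C_add, C_sub] at h4
    linear_combination h4

/-- **Smoothing principle.** A linear functional which is nonnegative on all polynomials of degree
`N` with roots below the barrier, and on all pure powers of degree `N + 1` below the barrier, is
nonnegative on all polynomials of degree `N + 1` with roots below the barrier: roots are pinched
together, two at a time, keeping the logarithmic derivative at `t` fixed. -/
theorem nonneg_of_isBelow (ℓ : ℝ[X] →ₗ[ℝ] ℝ) {t b : ℝ} (N : ℕ)
    (hlow : ∀ s : Multiset ℝ, s.card = N → IsBelow s t b → 0 ≤ ℓ (rootPoly s))
    (hpow : ∀ a : ℝ, 0 ≤ a → a < t → (N + 1 : ℝ) * b ≤ t - a → 0 ≤ ℓ ((X - C a) ^ (N + 1)))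
    (s : Multiset ℝ) (hcard : s.card = N + 1) (hs : IsBelow s t b) :
    0 ≤ ℓ (rootPoly s) := by
  classical
  obtain ⟨S, hS⟩ : ∃ S, S = (s.map fun r => (t - r)⁻¹).sum := ⟨_, rfl⟩
  have hN : (0 : ℝ) < N + 1 := by positivity
  obtain ⟨m, hm⟩ : ∃ m, m = S / (N + 1) := ⟨_, rfl⟩
  have hmS : (N + 1 : ℝ) * m = S := by rw [hm]; field_simp
  -- the induction is on the number of roots different from the common value `t - m⁻¹`
  suffices H : ∀ (k : ℕ) (s : Multiset ℝ), s.card = N + 1 → IsBelow s t b →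
      (s.map fun r => (t - r)⁻¹).sum = S → (s.filter (· ≠ t - m⁻¹)).card = k →
      0 ≤ ℓ (rootPoly s) from H _ s hcard hs hS.symm rfl
  clear hS hcard hs s
  intro k
  induction k using Nat.strong_induction_on with
  | _ k ih =>
  intro s hcard hs hS hk
  have hzero : (s.map fun r => (t - r)⁻¹ - m).sum = 0 := by
    rw [Multiset.sum_map_sub, hS]
    simp [hcard]
    linarith
  by_cases hall : ∀ r ∈ s, (t - r)⁻¹ - m = 0
  · have hrep : s = Multiset.replicate (N + 1) (t - m⁻¹) := by
      rw [Multiset.eq_replicate]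
      refine ⟨hcard, fun r hr => ?_⟩
      have := hall r hr
      rw [← sub_eq_zero.1 this, inv_inv]; ring
    have hmem : t - m⁻¹ ∈ s := by rw [hrep]; simp
    rw [hrep, rootPoly_replicate]
    refine hpow _ (hs.nonneg _ hmem) (hs.lt _ hmem) ?_
    have h1 := hs.lt _ hmem
    have h2 := hs.sum_le
    rw [hS, ← hmS] at h2
    have hm0 : 0 < m := inv_pos.1 (by linarith)
    rw [sub_sub_cancel, ← one_div, le_div_iff₀ hm0]
    linarith
  · push Not at hall
    obtain ⟨r, hr, hne⟩ := hall
    obtain ⟨r₁, hr₁, r₂, hr₂, h₁, h₂⟩ : ∃ r₁ ∈ s, ∃ r₂ ∈ s, (t - r₁)⁻¹ < m ∧ m < (t - r₂)⁻¹ := by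
      rcases lt_or_gt_of_ne hne with h | h
      · obtain ⟨q, hq, hq'⟩ := exists_neg_of_sum_eq_zero (s := s) (f := fun r => m - (t - r)⁻¹)
          (by
            have := congrArg Neg.neg hzero
            rw [← Multiset.sum_map_neg] at this
            simpa using this) hr (by linarith)
        exact ⟨r, hr, q, hq, by linarith, by linarith⟩
      · obtain ⟨q, hq, hq'⟩ := exists_neg_of_sum_eq_zero hzero hr h
        exact ⟨q, hq, r, hr, by linarith, by linarith⟩
    obtain ⟨g', rfl⟩ := Multiset.exists_cons_of_mem hr₁
    have hr₂' : r₂ ∈ g' := by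
      rcases Multiset.mem_cons.1 hr₂ with h | h
      · subst h; linarith
      · exact h
    obtain ⟨g, rfl⟩ := Multiset.exists_cons_of_mem hr₂'
    have ht₁ := hs.lt r₁ (by simp)
    have ht₂ := hs.lt r₂ (by simp)
    have hp₁ := hs.nonneg r₁ (by simp)
    have hp₂ := hs.nonneg r₂ (by simp)
    have ha : 0 < (t - r₁)⁻¹ := inv_pos.2 (by linarith)
    have he : 0 < (t - r₂)⁻¹ := inv_pos.2 (by linarith)
    have hinv : ∀ {z : ℝ}, (t - r₁)⁻¹ ≤ z → z⁻¹ ≤ t := fun {z} hz => by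
      have := inv_anti₀ ha hz
      rw [inv_inv] at this
      linarith
    obtain ⟨c, hc, hquad⟩ := pinch_quadratic ht₁ ht₂ h₁ h₂
    have hsplit : rootPoly (r₁ ::ₘ r₂ ::ₘ g) =
        rootPoly ((t - m⁻¹) ::ₘ (t - ((t - r₁)⁻¹ + (t - r₂)⁻¹ - m)⁻¹) ::ₘ g) +
        c • rootPoly ((t - ((t - r₁)⁻¹ + (t - r₂)⁻¹)⁻¹) ::ₘ g) := by
      simp only [rootPoly_cons, smul_eq_C_mul]
      linear_combination (rootPoly g) * hquad
    simp only [Multiset.map_cons, Multiset.sum_cons, Multiset.card_cons] at hS hcard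
    have hsum := hs.sum_le
    simp only [Multiset.map_cons, Multiset.sum_cons] at hsum
    have hg0 : ∀ q ∈ g, 0 ≤ q := fun q hq => hs.nonneg q (by simp [hq])
    have hg1 : ∀ q ∈ g, q < t := fun q hq => hs.lt q (by simp [hq])
    rw [hsplit, map_add, map_smul, smul_eq_mul]
    refine add_nonneg ?_ (mul_nonneg hc ?_)
    · refine ih _ ?_ _ (by simpa using hcard) ⟨?_, ?_, ?_⟩ ?_ rfl
      · rw [← hk]
        have e1 : r₁ ≠ t - m⁻¹ := by rintro rfl; simp at h₁
        have e2 : r₂ ≠ t - m⁻¹ := by rintro rfl; simp at h₂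
        rw [Multiset.filter_cons_of_neg (p := (· ≠ t - m⁻¹)) _ (by simp),
          Multiset.filter_cons_of_pos (p := (· ≠ t - m⁻¹)) _ e1,
          Multiset.filter_cons_of_pos (p := (· ≠ t - m⁻¹)) _ e2, Multiset.card_cons,
          Multiset.card_cons, Multiset.filter_cons, Multiset.card_add]
        split_ifs
        · simp; omega
        · simp
      · intro q hq
        simp only [Multiset.mem_cons] at hq
        rcases hq with rfl | rfl | hq
        · linarith [hinv h₁.le]
        · linarith [hinv (z := (t - r₁)⁻¹ + (t - r₂)⁻¹ - m) (by linarith)]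
        · exact hg0 q hq
      · intro q hq
        simp only [Multiset.mem_cons] at hq
        rcases hq with rfl | rfl | hq
        · linarith [inv_pos.2 (ha.trans h₁)]
        · have : 0 < (t - r₁)⁻¹ + (t - r₂)⁻¹ - m := by linarith
          linarith [inv_pos.2 this]
        · exact hg1 q hq
      · simp only [Multiset.map_cons, Multiset.sum_cons, sub_sub_cancel, inv_inv]
        refine le_trans (le_of_eq ?_) hsum
        ring
      · simp only [Multiset.map_cons, Multiset.sum_cons, sub_sub_cancel, inv_inv]
        rw [← hS]; ring
    · refine hlow _ (by simpa using hcard) ⟨?_, ?_, ?_⟩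
      · intro q hq
        simp only [Multiset.mem_cons] at hq
        rcases hq with rfl | hq
        · linarith [hinv (z := (t - r₁)⁻¹ + (t - r₂)⁻¹) (by linarith)]
        · exact hg0 q hq
      · intro q hq
        simp only [Multiset.mem_cons] at hq
        rcases hq with rfl | hq
        · linarith [inv_pos.2 (add_pos ha he)]
        · exact hg1 q hq
      · simp only [Multiset.map_cons, Multiset.sum_cons, sub_sub_cancel, inv_inv]
        refine le_trans (le_of_eq ?_) hsum
        ring

/-- If the barrier inequality of a real-rooted polynomial holds at all dilates `τ t`, `τ ≥ 1`, then
`t` is above all its roots: just above a root the logarithmic derivative is too large. -/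
theorem lt_of_barrier_nonneg {s : Multiset ℝ} {t b : ℝ} (ht : 0 < t) (hb : 0 < b)
    (h : ∀ τ : ℝ, 1 ≤ τ → 0 ≤ barrier (τ * t) (τ * b) (rootPoly s)) :
    ∀ r ∈ s, r < t := by
  classical
  by_contra! hc
  obtain ⟨r, hr, hrt⟩ := hc
  obtain ⟨ρ, hρ, hmax⟩ := s.toFinset.exists_max_image id ⟨r, by simpa using hr⟩
  simp only [Multiset.mem_toFinset, id] at hρ hmax
  have hρt : t ≤ ρ := hrt.trans (hmax r hr)
  -- evaluate at the point `ρ + b / 2`, which is above all roots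
  obtain ⟨τ, hτ⟩ : ∃ τ, τ = (ρ + b / 2) / t := ⟨_, rfl⟩
  have hτt : τ * t = ρ + b / 2 := by rw [hτ]; field_simp
  have hτ1 : 1 ≤ τ := by rw [hτ, le_div_iff₀ ht]; linarith
  have hlt : ∀ q ∈ s, q < τ * t := fun q hq => by linarith [hmax q hq]
  have h1 := h τ hτ1
  rw [barrier_rootPoly _ hlt] at h1
  have h2 := sub_nonneg.1 (nonneg_of_mul_nonneg_right h1 (rootPoly_eval_pos hlt))
  have h3 : (τ * t - ρ)⁻¹ ≤ (s.map fun r => (τ * t - r)⁻¹).sum := by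
    refine Multiset.single_le_sum ?_ _ (Multiset.mem_map_of_mem (fun r => (τ * t - r)⁻¹) hρ)
    intro x hx
    obtain ⟨q, hq, rfl⟩ := Multiset.mem_map.1 hx
    exact inv_nonneg.2 (by linarith [hlt q hq])
  rw [show τ * t - ρ = b / 2 by linarith] at h3
  have h4 : b ≤ τ * b := le_mul_of_one_le_left hb.le hτ1
  have h5 : b * (b / 2)⁻¹ = 2 := by field_simp
  have h6 : 0 < (b / 2)⁻¹ := by positivity
  nlinarith

/-! ### The convolution as a polynomial in a differential operator -/

/-- The operator `x D² + (κ + 1) D`, which is `x^(-κ) D x^(κ+1) D`. In the variables `x`, `y` it is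
`∂ₓ∂ᵧ` acting on `y^κ p(x y)`. -/
noncomputable def besselOp (κ : ℕ) : ℝ[X] →ₗ[ℝ] ℝ[X] :=
  LinearMap.mulLeft ℝ X ∘ₗ derivative ∘ₗ derivative + (κ + 1 : ℝ) • derivative

/-- The weights `k! (k + κ)!`: `besselOp κ` sends `x^(k+1) / (weight of k+1)` to
`x^k / (weight of k)`. -/
noncomputable def besselWeight (κ k : ℕ) : ℝ := (k.factorial : ℝ) * (k + κ).factorial

/-- The rectangular convolution of polynomials of degree at most `n` with `m = n + κ`, without the
normalising factor `1 / (n! m!)`, as a bilinear map: the polynomial `p` acts as a polynomial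
in `besselOp κ`. -/
noncomputable def besselConv (κ n : ℕ) : ℝ[X] →ₗ[ℝ] ℝ[X] →ₗ[ℝ] ℝ[X] :=
  ∑ i ∈ Finset.range (n + 1),
    besselWeight κ (n - i) • (lcoeff ℝ (n - i)).smulRight (besselOp κ ^ i)

theorem besselWeight_pos (κ k : ℕ) : 0 < besselWeight κ k := by
  unfold besselWeight; positivity

theorem besselWeight_succ (κ k : ℕ) :
    besselWeight κ (k + 1) = (k + 1) * (k + 1 + κ) * besselWeight κ k := by
  have : k + 1 + κ = (k + κ) + 1 := by ring
  simp only [besselWeight, this, Nat.factorial_succ]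
  push_cast
  ring

theorem besselOp_apply (κ : ℕ) (p : ℝ[X]) :
    besselOp κ p = X * derivative (derivative p) + C (κ + 1 : ℝ) * derivative p := by
  simp [besselOp, smul_eq_C_mul]

theorem coeff_besselOp (κ k : ℕ) (p : ℝ[X]) :
    (besselOp κ p).coeff k = (k + 1) * (k + 1 + κ) * p.coeff (k + 1) := by
  rw [besselOp_apply, coeff_add, coeff_C_mul, coeff_derivative]
  cases k with
  | zero => simp [add_comm]
  | succ k =>
    rw [coeff_X_mul, coeff_derivative, coeff_derivative]
    push_cast
    ring

theorem coeff_besselOp_pow (κ i k : ℕ) (p : ℝ[X]) :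
    besselWeight κ k * ((besselOp κ ^ i) p).coeff k =
      besselWeight κ (k + i) * p.coeff (k + i) := by
  induction i generalizing k with
  | zero => simp
  | succ i ih =>
    rw [pow_succ', Module.End.mul_apply, coeff_besselOp,
      show k + (i + 1) = (k + 1) + i by ring, ← ih (k + 1), besselWeight_succ]
    ring

theorem besselConv_apply (κ n : ℕ) (p q : ℝ[X]) :
    besselConv κ n p q = ∑ i ∈ Finset.range (n + 1),
      (besselWeight κ (n - i) * p.coeff (n - i)) • (besselOp κ ^ i) q := by
  simp [besselConv, LinearMap.sum_apply, smul_smul]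

theorem coeff_besselConv (κ n k : ℕ) (p q : ℝ[X]) :
    besselWeight κ k * (besselConv κ n p q).coeff k = ∑ i ∈ Finset.range (n + 1),
      (besselWeight κ (n - i) * p.coeff (n - i)) *
        (besselWeight κ (k + i) * q.coeff (k + i)) := by
  rw [besselConv_apply, finsetSum_coeff, Finset.mul_sum]
  refine Finset.sum_congr rfl fun i _ => ?_
  rw [coeff_smul, smul_eq_mul, ← coeff_besselOp_pow]
  ring

theorem coeff_besselConv_of_lt {κ n k : ℕ} (hk : n < k) (p : ℝ[X]) {q : ℝ[X]}
    (hq : q.natDegree ≤ n) : (besselConv κ n p q).coeff k = 0 := by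
  have h := coeff_besselConv κ n k p q
  rw [Finset.sum_eq_zero] at h
  · exact (mul_eq_zero.1 h).resolve_left (besselWeight_pos κ k).ne'
  · intro i _
    rw [coeff_eq_zero_of_natDegree_lt (p := q) (by omega)]
    ring

theorem coeff_besselConv_of_le {κ n k : ℕ} (hk : k ≤ n) (p : ℝ[X]) {q : ℝ[X]}
    (hq : q.natDegree ≤ n) :
    besselWeight κ k * (besselConv κ n p q).coeff k = ∑ i ∈ Finset.range (n - k + 1),
      (besselWeight κ (n - i) * p.coeff (n - i)) *
        (besselWeight κ (k + i) * q.coeff (k + i)) := by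
  rw [coeff_besselConv]
  symm
  refine Finset.sum_subset (Finset.range_subset_range.2 (by omega)) fun i _ hi' => ?_
  rw [Finset.mem_range] at hi'
  rw [coeff_eq_zero_of_natDegree_lt (p := q) (by omega)]
  ring

theorem besselConv_comm {κ n : ℕ} {p q : ℝ[X]} (hp : p.natDegree ≤ n) (hq : q.natDegree ≤ n) :
    besselConv κ n p q = besselConv κ n q p := by
  ext k
  rcases lt_or_ge n k with hk | hk
  · rw [coeff_besselConv_of_lt hk p hq, coeff_besselConv_of_lt hk q hp]
  · refine mul_left_cancel₀ (besselWeight_pos κ k).ne' ?_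
    rw [coeff_besselConv_of_le hk p hq, coeff_besselConv_of_le hk q hp,
      ← Finset.sum_range_reflect]
    refine Finset.sum_congr rfl fun i hi => ?_
    rw [Finset.mem_range] at hi
    rw [show n - (n - k + 1 - 1 - i) = k + i by omega,
      show k + (n - k + 1 - 1 - i) = n - i by omega, mul_comm]

/-- Convolving with a polynomial of smaller degree is a convolution in smaller degree. -/
theorem besselConv_succ_of_natDegree_le {κ n : ℕ} {p : ℝ[X]} (hp : p.natDegree ≤ n) (q : ℝ[X]) :
    besselConv κ (n + 1) p q = besselConv κ n p (besselOp κ q) := by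
  rw [besselConv_apply, Finset.sum_range_succ', besselConv_apply]
  rw [coeff_eq_zero_of_natDegree_lt (p := p) (by omega)]
  simp only [mul_zero, zero_smul, add_zero]
  refine Finset.sum_congr rfl fun i _ => ?_
  rw [show n + 1 - (i + 1) = n - i by omega, pow_succ, Module.End.mul_apply]

theorem rectConv_coeff_of_lt {m n k : ℕ} (hk : n < k) (p q : ℝ[X]) :
    (rectConv m n p q).coeff k = 0 := by
  rw [rectConv, finsetSum_coeff]
  refine Finset.sum_eq_zero fun l _ => ?_
  rw [coeff_C_mul, coeff_X_pow, if_neg (by omega), mul_zero]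

theorem rectConv_eq_besselConv (κ n : ℕ) (p : ℝ[X]) {q : ℝ[X]} (hq : q.natDegree ≤ n) :
    rectConv (n + κ) n p q = (besselWeight κ n)⁻¹ • besselConv κ n p q := by
  ext k
  rcases lt_or_ge n k with hk | hk
  · rw [rectConv_coeff_of_lt hk, coeff_smul, coeff_besselConv_of_lt hk p hq, smul_zero]
  · refine mul_left_cancel₀ (besselWeight_pos κ k).ne' ?_
    rw [coeff_smul, smul_eq_mul, mul_left_comm, coeff_besselConv_of_le hk p hq,
      rectConv, finsetSum_coeff,
      Finset.sum_eq_single_of_mem (n - k) (Finset.mem_range.2 (by omega)) fun l hl hne => by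
        rw [coeff_C_mul, coeff_X_pow, if_neg (by rw [Finset.mem_range] at hl; omega), mul_zero],
      coeff_C_mul, coeff_X_pow, if_pos (by omega), mul_one,
      Finset.Nat.sum_antidiagonal_eq_sum_range_succ_mk, Finset.mul_sum, Finset.mul_sum,
      Finset.mul_sum]
    refine Finset.sum_congr rfl fun i hi => ?_
    rw [Finset.mem_range] at hi
    obtain ⟨l, hl⟩ : ∃ l, n - k = i + l := ⟨n - k - i, by omega⟩
    rw [show n - (n - k) = k by omega, show n + κ - (n - k) = k + κ by omega,
      show n - (n - k - i) = k + i by omega, show n + κ - (n - k - i) = k + i + κ by omega,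
      show n + κ - i = n - i + κ by omega, hl, show i + l - i = l by omega]
    simp only [signedCoeff, besselWeight]
    rw [show n - l = k + i by omega]
    have h1 : ((-1 : ℝ) ^ (i + l)) * ((-1) ^ i * (-1) ^ l) = 1 := by
      rw [← pow_add, ← mul_pow]; norm_num
    have hkf : (k.factorial : ℝ) ≠ 0 := by positivity
    have hkf' : ((k + κ).factorial : ℝ) ≠ 0 := by positivity
    have hnf : (n.factorial : ℝ) ≠ 0 := by positivity
    have hnf' : ((n + κ).factorial : ℝ) ≠ 0 := by positivity
    field_simp
    linear_combination (p.coeff (n - i) * q.coeff (k + i)) * h1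

/-! ### Convolution of pure powers: Gegenbauer polynomials -/

/-- The monic Gegenbauer polynomials with parameter `κ + 1`, rescaled so that their roots lie in
`(-2 √w, 2 √w)`, defined by their three-term recurrence. -/
noncomputable def gegen (κ : ℕ) (w : ℝ) : ℕ → ℝ[X]
  | 0 => 1
  | 1 => X
  | n + 2 => X * gegen κ w (n + 1) -
      C ((n + 1) * (n + 2 * κ + 2) / ((n + 2 + κ) * (n + 1 + κ)) * w) * gegen κ w n

/-- The absolute values of the coefficients in the closed form of `gegen`. -/
noncomputable def gegenCoeff (κ n r : ℕ) : ℝ :=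
  n.descFactorial (2 * r) * (n + κ - r).factorial / ((n + κ).factorial * r.factorial)

theorem gegenCoeff_zero (κ n : ℕ) : gegenCoeff κ n 0 = 1 := by
  have : ((n + κ).factorial : ℝ) ≠ 0 := by positivity
  simp [gegenCoeff, this]

theorem gegenCoeff_eq_zero {κ n r : ℕ} (h : n < 2 * r) : gegenCoeff κ n r = 0 := by
  simp [gegenCoeff, Nat.descFactorial_of_lt h]

theorem gegenCoeff_succ_succ (κ n r : ℕ) :
    gegenCoeff κ (n + 2) (r + 1) = gegenCoeff κ (n + 1) (r + 1) +
      (n + 1) * (n + 2 * κ + 2) / ((n + 2 + κ) * (n + 1 + κ)) * gegenCoeff κ n r := by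
  rcases lt_or_ge n (2 * r) with h | h
  · rw [gegenCoeff_eq_zero h, gegenCoeff_eq_zero (by omega), gegenCoeff_eq_zero (by omega)]
    ring
  · obtain ⟨l, rfl⟩ := Nat.exists_eq_add_of_le h
    have e1 : (2 * r + l + 2).descFactorial (2 * (r + 1)) =
        (2 * r + l + 2) * ((2 * r + l + 1) * (2 * r + l).descFactorial (2 * r)) := by
      rw [show 2 * (r + 1) = 2 * r + 1 + 1 by ring, Nat.succ_descFactorial_succ,
        Nat.succ_descFactorial_succ]
    have e2 : (2 * r + l + 1).descFactorial (2 * (r + 1)) =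
        (2 * r + l + 1) * (l * (2 * r + l).descFactorial (2 * r)) := by
      rw [show 2 * (r + 1) = 2 * r + 1 + 1 by ring, Nat.succ_descFactorial_succ,
        Nat.descFactorial_succ, show 2 * r + l - 2 * r = l by omega]
    have e3 : 2 * r + l + 2 + κ - (r + 1) = (r + l + κ) + 1 := by omega
    have e4 : 2 * r + l + 1 + κ - (r + 1) = r + l + κ := by omega
    have e5 : 2 * r + l + κ - r = r + l + κ := by omega
    have e6 : 2 * r + l + 2 + κ = (2 * r + l + κ) + 1 + 1 := by omega
    have e7 : 2 * r + l + 1 + κ = (2 * r + l + κ) + 1 := by omega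
    rw [gegenCoeff, gegenCoeff, gegenCoeff, e1, e2, e3, e4, e5, e6, e7]
    simp only [Nat.factorial_succ]
    push_cast
    have h1 : ((r + l + κ).factorial : ℝ) ≠ 0 := by positivity
    have h2 : ((2 * r + l + κ).factorial : ℝ) ≠ 0 := by positivity
    have h3 : (r.factorial : ℝ) ≠ 0 := by positivity
    have h4 : (2 * r + l + κ + 1 : ℝ) ≠ 0 := by positivity
    have h5 : (2 * r + l + κ + 1 + 1 : ℝ) ≠ 0 := by positivity
    have h6 : (2 * r + l + 2 + κ : ℝ) ≠ 0 := by positivity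
    have h7 : (2 * r + l + 1 + κ : ℝ) ≠ 0 := by positivity
    have h8 : (r + 1 : ℝ) ≠ 0 := by positivity
    field_simp
    ring

theorem sum_gegenCoeff_extend (κ n : ℕ) (w : ℝ) {N : ℕ} (hN : n < N) :
    ∑ r ∈ Finset.range N, C (gegenCoeff κ n r * (-w) ^ r) * X ^ (n - 2 * r) =
      ∑ r ∈ Finset.range (n + 1), C (gegenCoeff κ n r * (-w) ^ r) * (X : ℝ[X]) ^ (n - 2 * r) := by
  symm
  refine Finset.sum_subset (Finset.range_subset_range.2 (by omega)) fun i _ hi' => ?_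
  rw [Finset.mem_range] at hi'
  rw [gegenCoeff_eq_zero (by omega)]
  simp

theorem gegen_eq_sum (κ : ℕ) (w : ℝ) (n : ℕ) : gegen κ w n =
    ∑ r ∈ Finset.range (n + 1), C (gegenCoeff κ n r * (-w) ^ r) * X ^ (n - 2 * r) := by
  induction n using Nat.twoStepInduction with
  | zero => simp [gegen, gegenCoeff_zero]
  | one => simp [gegen, Finset.sum_range_succ, gegenCoeff_zero, gegenCoeff_eq_zero]
  | more n ih1 ih2 =>
    rw [gegen, ih1, ih2, ← sum_gegenCoeff_extend κ (n + 1) w (N := n + 3) (by omega),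
      ← sum_gegenCoeff_extend κ n w (N := n + 2) (by omega), Finset.sum_range_succ' _ (n + 2),
      Finset.sum_range_succ' _ (n + 2), mul_add, Finset.mul_sum, Finset.mul_sum,
      add_sub_right_comm, ← Finset.sum_sub_distrib]
    congr 1
    · refine Finset.sum_congr rfl fun r _ => ?_
      rw [gegenCoeff_succ_succ]
      have hx : C (gegenCoeff κ (n + 1) (r + 1)) * (X * X ^ (n + 1 - 2 * (r + 1))) =
          C (gegenCoeff κ (n + 1) (r + 1)) * (X : ℝ[X]) ^ (n - 2 * r) := by
        rcases lt_or_ge (n + 1) (2 * (r + 1)) with h | h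
        · rw [gegenCoeff_eq_zero h]; simp
        · rw [← pow_succ', show n + 1 - 2 * (r + 1) + 1 = n - 2 * r by omega]
      rw [show n + 2 - 2 * (r + 1) = n - 2 * r by omega]
      simp only [C_mul, C_add, pow_succ, C_neg]
      linear_combination (C ((-w) ^ r) * -C w) * hx
    · simp [gegenCoeff_zero, pow_succ']

/-- The structure relation expressing the derivative of a Gegenbauer polynomial. -/
theorem gegen_derivative (κ : ℕ) (w : ℝ) (n : ℕ) (x : ℝ) :
    (x ^ 2 - 4 * w) * (derivative (gegen κ w (n + 1))).eval x =
      (n + 1) * x * (gegen κ w (n + 1)).eval x -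
        2 * (n + 1) * (n + 2 * κ + 2) / (n + 1 + κ) * w * (gegen κ w n).eval x := by
  have hrec : ∀ n : ℕ, (gegen κ w (n + 2)).eval x = x * (gegen κ w (n + 1)).eval x -
      (n + 1) * (n + 2 * κ + 2) / ((n + 2 + κ) * (n + 1 + κ)) * w * (gegen κ w n).eval x := by
    intro n; simp [gegen]
  have hdrec : ∀ n : ℕ, (derivative (gegen κ w (n + 2))).eval x = (gegen κ w (n + 1)).eval x +
      x * (derivative (gegen κ w (n + 1))).eval x -
      (n + 1) * (n + 2 * κ + 2) / ((n + 2 + κ) * (n + 1 + κ)) * w *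
        (derivative (gegen κ w n)).eval x := by
    intro n; simp [gegen]
  have h1 : (1 + κ : ℝ) ≠ 0 := by positivity
  have h2 : (2 + κ : ℝ) ≠ 0 := by positivity
  induction n using Nat.twoStepInduction with
  | zero =>
    simp [gegen]
    field_simp
    ring
  | one =>
    rw [hdrec, hrec]
    simp [gegen]
    have h3 : (1 + 1 + κ : ℝ) ≠ 0 := by positivity
    field_simp
    ring
  | more n ih1 ih2 =>
    have h3 : (n + 1 + κ : ℝ) ≠ 0 := by positivity
    have h4 : (n + 2 + κ : ℝ) ≠ 0 := by positivity
    have h5 : (n + 3 + κ : ℝ) ≠ 0 := by positivity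
    obtain ⟨A, hA⟩ : ∃ A : ℝ, A = (n + 1) * (n + 2 * κ + 2) / ((n + 2 + κ) * (n + 1 + κ)) :=
      ⟨_, rfl⟩
    obtain ⟨A', hA'⟩ : ∃ A : ℝ, A = (n + 2) * (n + 2 * κ + 3) / ((n + 3 + κ) * (n + 2 + κ)) :=
      ⟨_, rfl⟩
    have ih1' : (x ^ 2 - 4 * w) * (derivative (gegen κ w (n + 1))).eval x =
        (n + 1) * x * (gegen κ w (n + 1)).eval x -
          2 * (n + 2 + κ) * A * w * (gegen κ w n).eval x := by
      rw [ih1, hA]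
      field_simp
    have ih2' : (x ^ 2 - 4 * w) * (derivative (gegen κ w (n + 2))).eval x =
        (n + 2) * x * (gegen κ w (n + 2)).eval x -
          (2 * n + 2 * κ + 6) * A' * w * (gegen κ w (n + 1)).eval x := by
      rw [ih2, hA']
      push_cast
      have h6 : (n + 1 + 1 + κ : ℝ) ≠ 0 := by positivity
      field_simp
      ring
    have r1 : (gegen κ w (n + 2)).eval x = x * (gegen κ w (n + 1)).eval x -
        A * w * (gegen κ w n).eval x := by rw [hrec, hA]
    have r2 : (gegen κ w (n + 2 + 1)).eval x = x * (gegen κ w (n + 2)).eval x -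
        A' * w * (gegen κ w (n + 1)).eval x := by
      rw [hrec (n + 1), hA']
      push_cast
      ring
    have d2 : (derivative (gegen κ w (n + 2 + 1))).eval x = (gegen κ w (n + 2)).eval x +
        x * (derivative (gegen κ w (n + 2))).eval x -
        A' * w * (derivative (gegen κ w (n + 1))).eval x := by
      rw [hdrec (n + 1), hA']
      push_cast
      ring
    have e3 : 2 * ((n + 2 : ℕ) + 1) * ((n + 2 : ℕ) + 2 * κ + 2) / ((n + 2 : ℕ) + 1 + κ) =
        4 + 2 * (n + 2 + κ) * A' := by
      rw [hA']
      push_cast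
      have h6 : (n + 2 + 1 + κ : ℝ) ≠ 0 := by positivity
      field_simp
      ring
    rw [e3, d2, r2]
    push_cast
    linear_combination x * ih2' - A' * w * ih1' + 2 * (n + 2 + κ) * A' * w * r1

/-- Appell-type relation for `q = (x - μ)^n`: the operator `besselOp κ` acts on the derivatives
of `q` as a two-step shift. -/
theorem besselOp_iterate_derivative (κ n k : ℕ) (μ : ℝ) :
    besselOp κ (derivative^[k] ((X - C μ) ^ n)) =
      C (n - k + κ : ℝ) * derivative^[k + 1] ((X - C μ) ^ n) +
        C μ * derivative^[k + 2] ((X - C μ) ^ n) := by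
  have key : ∀ k : ℕ, (X - C μ) * derivative^[k + 1] ((X - C μ) ^ n) =
      C (n - k : ℝ) * derivative^[k] ((X - C μ) ^ n) := by
    intro k
    induction k with
    | zero =>
      rw [Function.iterate_one, derivative_X_sub_C_pow]
      cases n with
      | zero => simp
      | succ n => simp [pow_succ]; ring
    | succ k ih =>
      have := congrArg derivative ih
      rw [derivative_mul, derivative_C_mul, ← Function.iterate_succ_apply' derivative,
        ← Function.iterate_succ_apply' derivative, derivative_X_sub_C, one_mul] at this
      push_cast
      simp only [C_sub, C_add, C_1] at this ⊢
      linear_combination this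
  have h := key (k + 1)
  rw [besselOp_apply, ← Function.iterate_succ_apply' derivative,
    ← Function.iterate_succ_apply' derivative]
  push_cast at h
  simp only [C_sub, C_add, C_1] at h ⊢
  linear_combination h

theorem besselOp_pow_X_sub_C_pow (κ n j : ℕ) (hj : j ≤ n + κ) (μ : ℝ) :
    C ((n + κ - j).factorial : ℝ) * (besselOp κ ^ j) ((X - C μ) ^ n) =
      ∑ r ∈ Finset.range (j + 1), C ((j.choose r : ℝ) * μ ^ r * (n + κ - r).factorial) *
        derivative^[j + r] ((X - C μ) ^ n) := by
  induction j with
  | zero => simp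
  | succ j ih =>
    have hfac : ((n + κ - j).factorial : ℝ) = (n + κ - j) * (n + κ - (j + 1)).factorial := by
      rw [show n + κ - j = (n + κ - (j + 1)) + 1 by omega, Nat.factorial_succ]
      push_cast [Nat.cast_sub hj]
      ring
    have hpos : (n + κ - j : ℝ) ≠ 0 := by
      have : ((j + 1 : ℕ) : ℝ) ≤ (n + κ : ℕ) := by exact_mod_cast hj
      push_cast at this
      linarith
    have ih' := congrArg (besselOp κ) (ih (by omega))
    rw [← smul_eq_C_mul, map_smul, ← Module.End.mul_apply, ← pow_succ', smul_eq_C_mul,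
      map_sum] at ih'
    have hC : (C (n + κ - j : ℝ)) ≠ 0 := C_ne_zero.2 hpos
    refine mul_left_cancel₀ hC ?_
    rw [← mul_assoc, ← C_mul, ← hfac, ih', Finset.mul_sum, Finset.sum_range_succ' _ (j + 1)]
    have hsplit : ∀ r : ℕ, besselOp κ (C ((j.choose r : ℝ) * μ ^ r * (n + κ - r).factorial) *
          derivative^[j + r] ((X - C μ) ^ n)) =
        C ((j.choose r : ℝ) * μ ^ r * (n + κ - r).factorial * (n - (j + r) + κ)) *
            derivative^[j + 1 + r] ((X - C μ) ^ n) +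
          C ((j.choose r : ℝ) * μ ^ r * (n + κ - r).factorial * μ) *
            derivative^[j + 1 + (r + 1)] ((X - C μ) ^ n) := by
      intro r
      rw [← smul_eq_C_mul, map_smul, besselOp_iterate_derivative, smul_eq_C_mul,
        show j + r + 1 = j + 1 + r by ring, show j + r + 2 = j + 1 + (r + 1) by ring]
      push_cast
      simp only [C_mul]
      ring
    simp only [hsplit]
    rw [Finset.sum_add_distrib]
    have hext : ∑ r ∈ Finset.range (j + 1),
        C ((j.choose r : ℝ) * μ ^ r * (n + κ - r).factorial * (n - (j + r) + κ)) *
          derivative^[j + 1 + r] ((X - C μ) ^ n) =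
        ∑ r ∈ Finset.range (j + 2),
        C ((j.choose r : ℝ) * μ ^ r * (n + κ - r).factorial * (n - (j + r) + κ)) *
          derivative^[j + 1 + r] ((X - C μ) ^ n) := by
      rw [Finset.sum_range_succ _ (j + 1)]
      simp
    rw [hext, Finset.sum_range_succ' _ (j + 1), add_right_comm, ← Finset.sum_add_distrib]
    congr 1
    · refine Finset.sum_congr rfl fun r hr => ?_
      rw [Finset.mem_range] at hr
      rw [← mul_assoc, ← C_mul, ← add_mul, ← C_add]
      congr 2
      have h1 : ((n + κ - r).factorial : ℝ) = (n + κ - r) * (n + κ - (r + 1)).factorial := by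
        rw [show n + κ - r = (n + κ - (r + 1)) + 1 by omega, Nat.factorial_succ]
        push_cast [Nat.cast_sub (show r + 1 ≤ n + κ by omega)]
        ring
      have h2 : (j.choose (r + 1) : ℝ) * (r + 1) = j.choose r * (j - r) := by
        have := Nat.choose_succ_right_eq j r
        rw [← Nat.cast_sub (by omega : r ≤ j)]
        exact_mod_cast this
      rw [h1, Nat.choose_succ_succ]
      push_cast
      linear_combination (-(μ ^ (r + 1) * (n + κ - (r + 1)).factorial)) * h2
    · rw [← mul_assoc, ← C_mul]
      simp only [Nat.choose_zero_right, pow_zero, Nat.cast_zero, Nat.cast_one]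
      congr 2
      ring

/-- Taylor's formula as an identity of polynomials. -/
theorem sum_iterate_derivative_eq_comp (f : ℝ[X]) (c : ℝ) {N : ℕ} (hN : f.natDegree < N) :
    ∑ i ∈ Finset.range N, C (c ^ i / (i.factorial : ℝ)) * derivative^[i] f =
      f.comp (X + C c) := by
  apply Polynomial.funext
  intro x
  have h1 : (f.comp (X + C c)).eval x = (taylor x f).eval c := by
    rw [taylor_eval]; simp [add_comm]
  rw [h1, eval_eq_sum_range' (p := taylor x f) (n := N) (by rwa [natDegree_taylor]),
    eval_finsetSum]
  refine Finset.sum_congr rfl fun i _ => ?_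
  have hi : (i.factorial : ℝ) ≠ 0 := by positivity
  rw [taylor_coeff, ← factorial_smul_hasseDeriv, LinearMap.smul_apply, eval_mul, eval_C,
    nsmul_eq_mul, eval_mul, eval_natCast]
  field_simp

/-- The convolution of two pure powers is a translated Gegenbauer polynomial. -/
theorem besselConv_pow_pow (κ n : ℕ) (a μ : ℝ) :
    besselConv κ n ((X - C a) ^ n) ((X - C μ) ^ n) =
      C (besselWeight κ n) * (gegen κ (a * μ) n).comp (X - C (a + μ)) := by
  have hterm : ∀ i ∈ Finset.range (n + 1),
      (besselWeight κ (n - i) * ((X - C a) ^ n).coeff (n - i)) •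
        (besselOp κ ^ i) ((X - C μ) ^ n) =
      ∑ r ∈ Finset.range (i + 1), C ((n.factorial : ℝ) * (n + κ - r).factorial / r.factorial *
        (-a * μ) ^ r * ((-a) ^ (i - r) / (i - r).factorial)) *
        derivative^[2 * r + (i - r)] ((X - C μ) ^ n) := by
    intro i hi
    have hi : i ≤ n := by rw [Finset.mem_range] at hi; omega
    have hf : ((n + κ - i).factorial : ℝ) ≠ 0 := by positivity
    have h := besselOp_pow_X_sub_C_pow κ n i (by omega) μ
    have hch : (n.choose i : ℝ) * (n - i).factorial * i.factorial = n.factorial := by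
      have := Nat.choose_mul_factorial_mul_factorial hi
      rw [← this]; push_cast; ring
    rw [sub_eq_add_neg X (C a), ← C_neg, coeff_X_add_C_pow, show n - (n - i) = i by omega,
      Nat.choose_symm hi, smul_eq_C_mul, besselWeight, show n - i + κ = n + κ - i by omega,
      show ((n - i).factorial : ℝ) * (n + κ - i).factorial * ((-a) ^ i * n.choose i) =
        (n - i).factorial * ((-a) ^ i * n.choose i) * (n + κ - i).factorial by ring, C_mul,
      mul_assoc, h, Finset.mul_sum]
    refine Finset.sum_congr rfl fun r hr => ?_
    have hr : r ≤ i := by rw [Finset.mem_range] at hr; omega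
    rw [← mul_assoc, ← C_mul, show 2 * r + (i - r) = i + r by omega]
    congr 2
    have hch2 : (i.choose r : ℝ) * r.factorial * (i - r).factorial = i.factorial := by
      exact_mod_cast Nat.choose_mul_factorial_mul_factorial hr
    have h1 : (r.factorial : ℝ) ≠ 0 := by positivity
    have h2 : ((i - r).factorial : ℝ) ≠ 0 := by positivity
    obtain ⟨l, rfl⟩ := Nat.exists_eq_add_of_le hr
    rw [show r + l - r = l by omega] at *
    field_simp
    rw [← hch, ← hch2]
    ring
  rw [besselConv_apply, Finset.sum_congr rfl hterm]
  rw [Finset.sum_range_diag_flip (n + 1) fun r l =>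
    C ((n.factorial : ℝ) * (n + κ - r).factorial / r.factorial *
        (-a * μ) ^ r * ((-a) ^ l / l.factorial)) * derivative^[2 * r + l] ((X - C μ) ^ n)]
  rw [gegen_eq_sum, ← coe_compRingHom_apply, map_sum, Finset.mul_sum]
  simp only [coe_compRingHom_apply]
  refine Finset.sum_congr rfl fun r hr => ?_
  have hr : r ≤ n := by rw [Finset.mem_range] at hr; omega
  have hdeg : (derivative^[2 * r] ((X - C μ) ^ n)).natDegree < n + 1 - r := by
    refine lt_of_le_of_lt (natDegree_iterate_derivative _ _) ?_
    rw [natDegree_pow, natDegree_X_sub_C]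
    omega
  have htaylor := sum_iterate_derivative_eq_comp (derivative^[2 * r] ((X - C μ) ^ n)) (-a) hdeg
  have : ∀ l, C ((n.factorial : ℝ) * (n + κ - r).factorial / r.factorial *
        (-a * μ) ^ r * ((-a) ^ l / l.factorial)) * derivative^[2 * r + l] ((X - C μ) ^ n) =
      C ((n.factorial : ℝ) * (n + κ - r).factorial / r.factorial * (-a * μ) ^ r) *
        (C ((-a) ^ l / l.factorial) * derivative^[l] (derivative^[2 * r] ((X - C μ) ^ n))) := by
    intro l
    rw [add_comm (2 * r) l, Function.iterate_add_apply, C_mul, mul_assoc]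
  simp only [this]
  rw [← Finset.mul_sum, htaylor, iterate_derivative_X_sub_pow, nsmul_eq_mul, mul_comp, mul_comp,
    natCast_comp, pow_comp, pow_comp, sub_comp, X_comp, C_comp, X_comp, C_comp]
  have hX : X + C (-a) - C μ = X - C (a + μ) := by simp; ring
  rw [hX, ← C_eq_natCast, ← mul_assoc, ← mul_assoc, ← C_mul, ← C_mul]
  congr 2
  have h1 : ((n + κ).factorial : ℝ) ≠ 0 := by positivity
  have h2 : (r.factorial : ℝ) ≠ 0 := by positivity
  rw [gegenCoeff, besselWeight, neg_mul]
  field_simp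

/-! ### Ratio bounds for Gegenbauer polynomials -/

theorem gegen_eval_succ_succ (κ : ℕ) (w z : ℝ) (n : ℕ) :
    (gegen κ w (n + 2)).eval z = z * (gegen κ w (n + 1)).eval z -
      (n + 1) * (n + 2 * κ + 2) / ((n + 2 + κ) * (n + 1 + κ)) * w * (gegen κ w n).eval z := by
  simp [gegen]

/-- To the right of the interval `[-2 √w, 2 √w]` the ratios of consecutive Gegenbauer polynomials
are at least `z / 2`. -/
theorem gegen_pos_of_sq {κ : ℕ} {w z : ℝ} (hw : 0 ≤ w) (hz : 0 < z) (hD : 4 * w ≤ z ^ 2) (n : ℕ) :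
    0 < (gegen κ w n).eval z ∧ z / 2 * (gegen κ w n).eval z ≤ (gegen κ w (n + 1)).eval z := by
  induction n with
  | zero => simp [gegen]; linarith
  | succ n ih =>
    obtain ⟨h0, h1⟩ := ih
    have hpos : 0 < (gegen κ w (n + 1)).eval z := lt_of_lt_of_le (by positivity) h1
    refine ⟨hpos, ?_⟩
    rw [show n + 1 + 1 = n + 2 by ring, gegen_eval_succ_succ]
    have ha : (n + 1) * (n + 2 * κ + 2) / ((n + 2 + κ) * (n + 1 + κ)) ≤ (1 : ℝ) := by
      rw [div_le_one (by positivity)]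
      nlinarith [sq_nonneg (κ : ℝ), Nat.cast_nonneg (α := ℝ) κ, Nat.cast_nonneg (α := ℝ) n]
    have hw0 : 0 ≤ w * (gegen κ w n).eval z := mul_nonneg hw h0.le
    have h2 : (n + 1) * (n + 2 * κ + 2) / ((n + 2 + κ) * (n + 1 + κ)) * w * (gegen κ w n).eval z ≤
        w * (gegen κ w n).eval z := by
      rw [mul_assoc]; exact mul_le_of_le_one_left hw0 ha
    have h3 : w * (gegen κ w n).eval z ≤ z / 2 * (gegen κ w (n + 1)).eval z := by
      refine le_trans ?_ (mul_le_mul_of_nonneg_left h1 (by positivity))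
      nlinarith
    linarith

/-- One step of the induction for the ratio bound; the two directions of the inequality are treated
together by means of the sign `σ`. -/
theorem ratio_step {σ j k z w Δ Δ' H₀ H₁ H₂ : ℝ} (hj : 0 < j) (hk : 0 ≤ k) (hH : 0 ≤ H₁)
    (hrec : H₂ = z * H₁ - j * (j + 2 * k + 1) / ((j + k + 1) * (j + k)) * w * H₀)
    (hU : σ * ((j + k) * ((j + k) * z - Δ) * H₁) ≤ σ * (2 * j * (j + 2 * k + 1) * w * H₀))
    (hS : σ * (k * z + (j + 1 + 2 * k) * Δ) ≤ σ * ((j + 2 * k + 2) * Δ')) :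
    σ * (2 * (j + 1 + k) * (j + 1 + 2 * k) * H₂) ≤
      σ * ((j + 2 * k + 2) * ((j + 1 + k) * z + Δ') * H₁) := by
  have h1 : 2 * (j + 1 + k) * (j + 1 + 2 * k) * H₂ =
      2 * (j + 1 + k) * (j + 1 + 2 * k) * z * H₁ -
        (j + 1 + 2 * k) * (2 * j * (j + 2 * k + 1) * w * H₀) / (j + k) := by
    rw [hrec]
    field_simp
    ring
  have h2 : σ * ((j + k) * z - Δ) * H₁ ≤ σ * (2 * j * (j + 2 * k + 1) * w * H₀) / (j + k) := by
    rw [le_div_iff₀ (by positivity)]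
    linarith
  have h3 := mul_le_mul_of_nonneg_left h2 (by positivity : 0 ≤ j + 1 + 2 * k)
  have h4 := mul_le_mul_of_nonneg_right hS hH
  rw [h1]
  have h5 : σ * ((j + 1 + 2 * k) * (2 * j * (j + 2 * k + 1) * w * H₀) / (j + k)) =
      (j + 1 + 2 * k) * (σ * (2 * j * (j + 2 * k + 1) * w * H₀) / (j + k)) := by ring
  rw [mul_sub, h5]
  linarith

/-- An upper bound for `σ H₁ / H₀`, multiplied by the conjugate `(j + k) z - Δ`, becomes the form of
the bound that the three-term recurrence uses. -/
theorem ratio_convert {σ j k z w Δ H₀ H₁ : ℝ} (hj : 0 < j) (hk : 0 ≤ k)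
    (hΔ : Δ ^ 2 = (j + k) ^ 2 * z ^ 2 - 4 * j * (j + 2 * k) * w) (hle : Δ ≤ (j + k) * z)
    (h : σ * (2 * (j + k) * (j + 2 * k) * H₁) ≤ σ * ((j + 2 * k + 1) * ((j + k) * z + Δ) * H₀)) :
    σ * ((j + k) * ((j + k) * z - Δ) * H₁) ≤ σ * (2 * j * (j + 2 * k + 1) * w * H₀) := by
  have h1 := mul_le_mul_of_nonneg_right h (sub_nonneg.2 hle)
  have h2 : 0 < 2 * (j + 2 * k) := by positivity
  refine le_of_mul_le_mul_left ?_ h2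
  have h3 : σ * ((j + 2 * k + 1) * ((j + k) * z + Δ) * H₀) * ((j + k) * z - Δ) =
      2 * (j + 2 * k) * (σ * (2 * j * (j + 2 * k + 1) * w * H₀)) := by
    linear_combination (-σ * (j + 2 * k + 1) * H₀) * hΔ
  rw [h3] at h1
  linarith

/-- The discriminant governing the ratio bounds for Gegenbauer polynomials. -/
noncomputable def gegenDisc (κ : ℕ) (z w : ℝ) (j : ℝ) : ℝ :=
  √(κ ^ 2 * z ^ 2 + j * (j + 2 * κ) * (z ^ 2 - 4 * w))

/-- Bounds on the ratio of consecutive Gegenbauer polynomials, an upper bound for `σ = 1` and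
`z² > 4 w`, a lower bound for `σ = -1` and `z² < 4 w`. -/
theorem gegen_ratio {κ : ℕ} {w z σ : ℝ} (hw : 0 ≤ w) (hz : 0 < z)
    (hσ : σ = 1 ∧ 0 < z ^ 2 - 4 * w ∨ σ = -1 ∧ z ^ 2 - 4 * w < 0) (n : ℕ)
    (hdisc : 0 ≤ κ ^ 2 * z ^ 2 + (n + 1) * (n + 1 + 2 * κ) * (z ^ 2 - 4 * w)) :
    0 < (gegen κ w (n + 1)).eval z ∧
      σ * ((n + 1 + κ) * ((n + 1 + κ) * z - gegenDisc κ z w (n + 1)) *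
        (gegen κ w (n + 1)).eval z) ≤
      σ * (2 * (n + 1) * (n + 1 + 2 * κ + 1) * w * (gegen κ w n).eval z) := by
  have hk : (0 : ℝ) ≤ κ := Nat.cast_nonneg κ
  have hsq : ∀ {j : ℝ}, 0 ≤ κ ^ 2 * z ^ 2 + j * (j + 2 * κ) * (z ^ 2 - 4 * w) →
      gegenDisc κ z w j ^ 2 = (j + κ) ^ 2 * z ^ 2 - 4 * j * (j + 2 * κ) * w := by
    intro j hj
    rw [gegenDisc, Real.sq_sqrt hj]; ring
  have hle : ∀ {j : ℝ}, 0 ≤ j → gegenDisc κ z w j ≤ (j + κ) * z := by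
    intro j hj
    refine Real.sqrt_le_iff.2 ⟨by positivity, ?_⟩
    nlinarith [mul_nonneg (mul_nonneg hj (by positivity : 0 ≤ j + 2 * κ)) hw]
  have hkz : ∀ {j : ℝ}, 0 ≤ j → σ * (κ * z) ≤ σ * gegenDisc κ z w j := by
    intro j hj
    have hj2 : 0 ≤ j * (j + 2 * κ) := by positivity
    rcases hσ with ⟨rfl, hD⟩ | ⟨rfl, hD⟩
    · rw [one_mul, one_mul]
      refine Real.le_sqrt_of_sq_le ?_
      nlinarith
    · have : gegenDisc κ z w j ≤ κ * z := by
        refine Real.sqrt_le_iff.2 ⟨by positivity, ?_⟩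
        nlinarith
      linarith
  have hmono : ∀ {j : ℝ}, 0 ≤ j → σ * gegenDisc κ z w j ≤ σ * gegenDisc κ z w (j + 1) := by
    intro j hj
    have hj2 : j * (j + 2 * κ) ≤ (j + 1) * (j + 1 + 2 * κ) := by nlinarith
    rcases hσ with ⟨rfl, hD⟩ | ⟨rfl, hD⟩
    · rw [one_mul, one_mul]
      exact Real.sqrt_le_sqrt (by nlinarith)
    · have : gegenDisc κ z w (j + 1) ≤ gegenDisc κ z w j := Real.sqrt_le_sqrt (by nlinarith)
      linarith
  have hpos : ∀ {j H₀ H₁ : ℝ}, 0 < j → 0 < H₀ →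
      (σ = 1 → 0 < H₁) →
      σ * (2 * (j + κ) * (j + 2 * κ) * H₁) ≤
        σ * ((j + 2 * κ + 1) * ((j + κ) * z + gegenDisc κ z w j) * H₀) → 0 < H₁ := by
    intro j H₀ H₁ hj hH hc h
    rcases hσ with ⟨rfl, hD⟩ | ⟨rfl, hD⟩
    · exact hc rfl
    · have hs : 0 ≤ gegenDisc κ z w j := Real.sqrt_nonneg _
      have h1 : 0 < (j + 2 * κ + 1) * ((j + κ) * z + gegenDisc κ z w j) * H₀ := by positivity
      have h2 : 0 < 2 * (j + κ) * (j + 2 * κ) * H₁ := by linarith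
      exact pos_of_mul_pos_right h2 (by positivity)
  induction n with
  | zero =>
    have h1 : σ * (2 * (1 + κ) * (1 + 2 * κ) * (gegen κ w 1).eval z) ≤
        σ * ((1 + 2 * κ + 1) * ((1 + κ) * z + gegenDisc κ z w 1) * (gegen κ w 0).eval z) := by
      have := mul_le_mul_of_nonneg_left (hkz zero_le_one) (by positivity : 0 ≤ 2 * (1 + κ : ℝ))
      simp only [gegen, eval_X, eval_one]
      linarith
    norm_num at hdisc ⊢
    have h2 := ratio_convert zero_lt_one hk (hsq (j := 1) (by linarith)) (hle zero_le_one) h1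
    refine ⟨by simpa [gegen] using hz, ?_⟩
    linarith
  | succ n ih =>
    have hE : 0 ≤ κ ^ 2 * z ^ 2 + (n + 1) * (n + 1 + 2 * κ) * (z ^ 2 - 4 * w) := by
      have hn : (0 : ℝ) ≤ (n + 1) * (n + 1 + 2 * κ) := by positivity
      rcases hσ with ⟨_, hD⟩ | ⟨_, hD⟩
      · positivity
      · push_cast at hdisc
        nlinarith
    obtain ⟨hH, hU⟩ := ih hE
    have hj : (0 : ℝ) < n + 1 := by positivity
    have hS : σ * (κ * z + (n + 1 + 1 + 2 * κ) * gegenDisc κ z w (n + 1)) ≤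
        σ * ((n + 1 + 2 * κ + 2) * gegenDisc κ z w (n + 1 + 1)) := by
      have h1 := mul_le_mul_of_nonneg_left (hmono hj.le)
        (by positivity : (0 : ℝ) ≤ n + 1 + 1 + 2 * κ)
      have h2 := hkz (by positivity : (0 : ℝ) ≤ n + 1 + 1)
      linarith
    have hrec : (gegen κ w (n + 1 + 1)).eval z = z * (gegen κ w (n + 1)).eval z -
        (n + 1) * (n + 1 + 2 * κ + 1) / ((n + 1 + κ + 1) * (n + 1 + κ)) * w *
          (gegen κ w n).eval z := by
      rw [show n + 1 + 1 = n + 2 by ring, gegen_eval_succ_succ]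
      congr 4 <;> ring
    have hB := ratio_step hj hk hH.le hrec hU hS
    push_cast at hdisc ⊢
    refine ⟨hpos (by positivity : (0 : ℝ) < n + 1 + 1) hH (fun h => ?_)
      (le_of_le_of_eq hB (by ring)),
      ratio_convert (by positivity) hk (hsq hdisc) (hle (by positivity))
        (le_of_le_of_eq hB (by ring))⟩
    rcases hσ with ⟨_, hD⟩ | ⟨h', _⟩
    · exact (gegen_pos_of_sq hw hz (by linarith) (n + 1 + 1)).1
    · rw [h] at h'; norm_num at h'

/-- The barrier inequality for Gegenbauer polynomials away from the turning point. -/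
theorem gegen_barrier_of_ne {κ : ℕ} {w z Y s : ℝ} (n : ℕ) (hw : 0 ≤ w) (hY : 0 < Y) (hs : 0 ≤ s)
    (hz : 2 * s + (n + 1) * Y ≤ z) (hws : w ≤ s * (s + (n + 1 + κ) * Y))
    (hD : z ^ 2 - 4 * w ≠ 0) :
    Y * (derivative (gegen κ w (n + 1))).eval z ≤ (gegen κ w (n + 1)).eval z := by
  have hk : (0 : ℝ) ≤ κ := Nat.cast_nonneg κ
  obtain ⟨j, hj⟩ : ∃ j : ℝ, j = n + 1 := ⟨_, rfl⟩
  have hj0 : 0 < j := by rw [hj]; positivity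
  rw [← hj] at hz hws
  have hz0 : 0 < z := by nlinarith
  have hdisc : ((j + κ) * j * Y - 2 * κ * s) ^ 2 ≤
      κ ^ 2 * z ^ 2 + j * (j + 2 * κ) * (z ^ 2 - 4 * w) := by
    have h1 : (2 * s + j * Y) ^ 2 ≤ z ^ 2 := pow_le_pow_left₀ (by positivity) hz 2
    have h2 := mul_le_mul_of_nonneg_left h1 (sq_nonneg (j + κ))
    have h3 := mul_le_mul_of_nonneg_left hws (by positivity : 0 ≤ 4 * (j * (j + 2 * κ)))
    linarith
  have hbar : j * (j + 2 * κ) * Y ≤ gegenDisc κ z w j + κ * z := by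
    have h1 : (j + κ) * j * Y - 2 * κ * s ≤ gegenDisc κ z w j :=
      Real.le_sqrt_of_sq_le hdisc
    nlinarith
  obtain ⟨σ, hσ⟩ : ∃ σ : ℝ, σ = 1 ∧ 0 < z ^ 2 - 4 * w ∨ σ = -1 ∧ z ^ 2 - 4 * w < 0 := by
    rcases lt_or_gt_of_ne hD with h | h
    · exact ⟨-1, Or.inr ⟨rfl, h⟩⟩
    · exact ⟨1, Or.inl ⟨rfl, h⟩⟩
  have hE : 0 ≤ κ ^ 2 * z ^ 2 + j * (j + 2 * κ) * (z ^ 2 - 4 * w) := (sq_nonneg _).trans hdisc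
  obtain ⟨hpos, hU⟩ := gegen_ratio hw hz0 hσ n (by rw [← hj]; exact hE)
  have hder := gegen_derivative κ w n z
  have hc : (n + 2 * κ + 2 : ℝ) = j + 2 * κ + 1 := by rw [hj]; ring
  rw [hc] at hder
  rw [← hj] at hU hder
  obtain ⟨Δ, hΔ⟩ : ∃ Δ, Δ = gegenDisc κ z w j := ⟨_, rfl⟩
  have hΔ2 : Δ ^ 2 = κ ^ 2 * z ^ 2 + j * (j + 2 * κ) * (z ^ 2 - 4 * w) := by
    rw [hΔ, gegenDisc, Real.sq_sqrt hE]
  have hΔ0 : 0 ≤ Δ := hΔ ▸ Real.sqrt_nonneg _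
  rw [← hΔ] at hbar hU
  obtain ⟨H, hH⟩ : ∃ H, H = (gegen κ w (n + 1)).eval z := ⟨_, rfl⟩
  obtain ⟨H', hH'⟩ : ∃ H, H = (derivative (gegen κ w (n + 1))).eval z := ⟨_, rfl⟩
  obtain ⟨G, hG⟩ : ∃ G, G = (gegen κ w n).eval z := ⟨_, rfl⟩
  rw [← hH, ← hG] at hU
  rw [← hH, ← hH', ← hG] at hder
  rw [← hH] at hpos
  rw [← hH, ← hH']
  have hder2 : (j + κ) * ((z ^ 2 - 4 * w) * H') =
      (j + κ) * (j * z * H) - 2 * j * (j + 2 * κ + 1) * w * G := by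
    rw [hder]
    field_simp
  have h1 : σ * ((z ^ 2 - 4 * w) * H') ≤ σ * ((Δ - κ * z) * H) := by
    refine le_of_mul_le_mul_left ?_ (by positivity : 0 < j + κ)
    rw [mul_left_comm, hder2]
    linarith
  have h2 : (Δ + κ * z) * H' ≤ j * (j + 2 * κ) * H := by
    have h3 := mul_le_mul_of_nonneg_right h1 (by positivity : 0 ≤ Δ + κ * z)
    have h4 : σ * ((Δ - κ * z) * H) * (Δ + κ * z) =
        σ * (z ^ 2 - 4 * w) * (j * (j + 2 * κ) * H) := by
      linear_combination (σ * H) * hΔ2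
    have h5 : 0 < σ * (z ^ 2 - 4 * w) := by
      rcases hσ with ⟨rfl, h⟩ | ⟨rfl, h⟩ <;> linarith
    refine le_of_mul_le_mul_left ?_ h5
    rw [← h4]
    linarith
  rcases le_or_gt 0 H' with h | h
  · have h3 := mul_le_mul_of_nonneg_right hbar h
    refine le_of_mul_le_mul_left ?_ (by positivity : 0 < j * (j + 2 * κ))
    linarith
  · nlinarith

theorem continuous_gegen_eval (κ n : ℕ) (z : ℝ) :
    Continuous fun w => (gegen κ w n).eval z := by
  simp only [gegen_eq_sum, eval_finsetSum, eval_mul, eval_C, eval_pow, eval_X]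
  fun_prop

theorem continuous_gegen_derivative_eval (κ n : ℕ) (z : ℝ) :
    Continuous fun w => (derivative (gegen κ w n)).eval z := by
  simp only [gegen_eq_sum, derivative_sum, derivative_C_mul, eval_finsetSum, eval_mul, eval_C]
  fun_prop

/-- The barrier inequality for Gegenbauer polynomials. -/
theorem gegen_barrier {κ : ℕ} {w z Y s : ℝ} (n : ℕ) (hw : 0 ≤ w) (hY : 0 < Y) (hs : 0 ≤ s)
    (hz : 2 * s + (n + 1) * Y ≤ z) (hws : w ≤ s * (s + (n + 1 + κ) * Y)) :
    Y * (derivative (gegen κ w (n + 1))).eval z ≤ (gegen κ w (n + 1)).eval z := by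
  rcases eq_or_ne (z ^ 2 - 4 * w) 0 with hD | hD
  · -- at the turning point, let `w` increase to its value
    have hz0 : 0 < z := by
      have : (0 : ℝ) < (n + 1) * Y := by positivity
      linarith
    have hw0 : 0 < w := by nlinarith
    have hev : ∀ᶠ v in nhdsWithin w (Set.Iio w),
        Y * (derivative (gegen κ v (n + 1))).eval z ≤ (gegen κ v (n + 1)).eval z := by
      filter_upwards [Ioo_mem_nhdsLT hw0] with v hv
      exact gegen_barrier_of_ne n hv.1.le hY hs hz (hv.2.le.trans hws) (by linarith [hv.2])
    have h1 : Filter.Tendsto (fun v => Y * (derivative (gegen κ v (n + 1))).eval z)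
        (nhdsWithin w (Set.Iio w)) (nhds (Y * (derivative (gegen κ w (n + 1))).eval z)) :=
      (((continuous_gegen_derivative_eval κ (n + 1) z).const_mul Y).tendsto w).mono_left
        nhdsWithin_le_nhds
    have h2 : Filter.Tendsto (fun v => (gegen κ v (n + 1)).eval z)
        (nhdsWithin w (Set.Iio w)) (nhds ((gegen κ w (n + 1)).eval z)) :=
      ((continuous_gegen_eval κ (n + 1) z).tendsto w).mono_left nhdsWithin_le_nhds
    exact le_of_tendsto_of_tendsto h1 h2 hev
  · exact gegen_barrier_of_ne n hw hY hs hz hws hD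

/-! ### The barrier theorem for the convolution -/

theorem splits_derivative_of_splits {p : ℝ[X]} (hp : p.Splits) : (derivative p).Splits := by
  rw [splits_iff_card_roots] at hp ⊢
  have h1 := card_roots_le_derivative p
  have h2 := card_roots' (derivative p)
  have h3 := natDegree_derivative_le p
  rcases Nat.eq_zero_or_pos p.natDegree with h | h
  · rw [eq_C_of_natDegree_eq_zero h]
    simp
  · omega

theorem nonneg_of_isRoot_derivative {p : ℝ[X]} (hp : p.Splits) (h0 : p ≠ 0)
    (hd : derivative p ≠ 0) (h : ∀ r, p.IsRoot r → 0 ≤ r) :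
    ∀ r, (derivative p).IsRoot r → 0 ≤ r := by
  intro r hr
  by_contra! hneg
  have hpr : p.eval r ≠ 0 := fun h' => absurd (h r h') (not_le.2 hneg)
  have h1 := hp.eval_derivative_eq_eval_mul_sum hpr
  rw [hr.eq_zero, eq_comm, mul_eq_zero] at h1
  have h2 := h1.resolve_left hpr
  have hcard : p.roots ≠ 0 := by
    intro h3
    apply hd
    have h4 := splits_iff_card_roots.1 hp
    rw [h3, Multiset.card_zero] at h4
    rw [eq_C_of_natDegree_eq_zero h4.symm, derivative_C]
  obtain ⟨q, hq⟩ := Multiset.exists_mem_of_ne_zero hcard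
  have hneg' : ∀ z ∈ p.roots, 1 / (r - z) < 0 := fun z hz =>
    one_div_neg.2 (by linarith [h z ((mem_roots h0).1 hz)])
  have h3 : 0 < (p.roots.map fun z => -(1 / (r - z))).sum := by
    refine lt_of_lt_of_le (neg_pos.2 (hneg' q hq)) (Multiset.single_le_sum ?_ _
      (Multiset.mem_map_of_mem (fun z => -(1 / (r - z))) hq))
    intro x hx
    obtain ⟨z, hz, rfl⟩ := Multiset.mem_map.1 hx
    linarith [hneg' z hz]
  rw [Multiset.sum_map_neg, h2] at h3
  simp at h3

/-- By Rolle's theorem, applied twice, `besselOp κ` preserves polynomials with only nonnegative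
real roots. -/
theorem exists_besselOp_rootPoly (κ n : ℕ) {s : Multiset ℝ} (hcard : s.card = n + 1)
    (hs : ∀ r ∈ s, 0 ≤ r) :
    ∃ s' : Multiset ℝ, s'.card = n ∧ (∀ r ∈ s', 0 ≤ r) ∧
      besselOp κ (rootPoly s) = C ((n + 1) * (n + 1 + κ) : ℝ) * rootPoly s' := by
  obtain ⟨p, hp⟩ : ∃ p, p = rootPoly s := ⟨_, rfl⟩
  have hp0 : p ≠ 0 := hp ▸ (rootPoly_monic s).ne_zero
  have hps : p.Splits := hp ▸ rootPoly_splits s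
  have hpr : ∀ r, p.IsRoot r → 0 ≤ r := fun r hr =>
    hs r (by rw [← rootPoly_roots s, ← hp]; exact (mem_roots hp0).2 hr)
  have hdeg : p.natDegree = n + 1 := by rw [hp, rootPoly_natDegree, hcard]
  have hlead : p.coeff (n + 1) = 1 := by
    have := rootPoly_monic s
    rwa [Monic, leadingCoeff, ← hp, hdeg] at this
  have hcoeff : (besselOp κ p).coeff n = (n + 1) * (n + 1 + κ) := by
    rw [coeff_besselOp, hlead, mul_one]
  have hcpos : (0 : ℝ) < (n + 1) * (n + 1 + κ) := by positivity
  have hb0 : besselOp κ p ≠ 0 := by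
    intro h
    rw [h, coeff_zero] at hcoeff
    exact hcpos.ne hcoeff
  have hd0 : derivative p ≠ 0 := by
    intro h
    rw [besselOp_apply, h] at hb0
    simp at hb0
  have hbdeg : (besselOp κ p).natDegree = n := by
    refine natDegree_eq_of_le_of_coeff_ne_zero ?_ (by rw [hcoeff]; exact hcpos.ne')
    refine natDegree_le_iff_coeff_eq_zero.2 fun k hk => ?_
    rw [coeff_besselOp, coeff_eq_zero_of_natDegree_lt (by omega), mul_zero]
  -- the factorisation `x^κ M = D x^(κ+1) D`
  have hX : derivative (X ^ (κ + 1) * derivative p) = X ^ κ * besselOp κ p := by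
    rw [besselOp_apply, derivative_mul, derivative_X_pow]
    simp only [C_add, C_1, map_natCast, Nat.add_sub_cancel]
    push_cast
    ring
  have hXs : (X ^ (κ + 1) * derivative p).Splits :=
    (Splits.X_pow _).mul (splits_derivative_of_splits hps)
  have hX0 : X ^ (κ + 1) * derivative p ≠ 0 := mul_ne_zero (by simp) hd0
  have hXd : X ^ κ * besselOp κ p ≠ 0 := mul_ne_zero (by simp) hb0
  have hbs : (besselOp κ p).Splits :=
    Splits.of_dvd (hX ▸ splits_derivative_of_splits hXs) hXd (dvd_mul_left _ _)
  have hbr : ∀ r, (besselOp κ p).IsRoot r → 0 ≤ r := by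
    intro r hr
    refine nonneg_of_isRoot_derivative hXs hX0 (by rwa [hX]) ?_ r ?_
    · intro q hq
      rw [IsRoot, eval_mul, mul_eq_zero] at hq
      rcases hq with hq | hq
      · simp at hq
        exact hq.ge
      · exact nonneg_of_isRoot_derivative hps hp0 hd0 hpr q hq
    · rw [hX, IsRoot, eval_mul, hr.eq_zero, mul_zero]
  refine ⟨(besselOp κ p).roots, ?_, fun r hr => hbr r ((mem_roots hb0).1 hr), ?_⟩
  · rw [splits_iff_card_roots.1 hbs, hbdeg]
  · rw [← hp]
    have := hbs.eq_prod_roots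
    rwa [leadingCoeff, hbdeg, hcoeff] at this

theorem isBelow_replicate {n : ℕ} {a t b : ℝ} (h0 : 0 ≤ a) (h1 : a < t)
    (h : n * b ≤ t - a) : IsBelow (Multiset.replicate n a) t b := by
  refine ⟨fun r hr => (Multiset.eq_of_mem_replicate hr) ▸ h0,
    fun r hr => (Multiset.eq_of_mem_replicate hr) ▸ h1, ?_⟩
  rw [Multiset.map_replicate, Multiset.sum_replicate, nsmul_eq_mul, ← mul_assoc, mul_comm b,
    ← div_eq_mul_inv, div_le_one (by linarith)]
  exact h

/-- The effect of `besselOp κ` on the barrier, for a pure power. -/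
theorem barrier_besselOp_pow (κ n : ℕ) {α x a : ℝ} (hα : 0 < α) (hx : (n + 1) * α ≤ x)
    (h : (n + 1) * (α * (x + κ * α)) ≤ x * (x + κ * α) - a) :
    0 ≤ barrier ((x - α) * (x - α + κ * α)) (α * (x - α + κ * α))
      (besselOp κ ((X - C a) ^ (n + 1))) := by
  have hop := besselOp_iterate_derivative κ (n + 1) 0 a
  simp only [Function.iterate_zero, id, zero_add, Function.iterate_one] at hop
  cases n with
  | zero =>
    have hX : besselOp κ ((X - C a) ^ (0 + 1)) = C (1 + κ : ℝ) := by
      rw [hop]; simp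
    rw [hX, barrier_apply]
    simp
    positivity
  | succ k =>
    have hk : (0 : ℝ) ≤ k := Nat.cast_nonneg k
    have hκ : (0 : ℝ) ≤ κ := Nat.cast_nonneg κ
    have hX : besselOp κ ((X - C a) ^ (k + 1 + 1)) = C (k + 2 : ℝ) * ((X - C a) ^ k *
        (C (k + 2 + κ : ℝ) * (X - C a) + C (a * (k + 1)))) := by
      rw [hop, iterate_derivative_X_sub_pow, derivative_X_sub_C_pow]
      simp only [Nat.descFactorial_succ, Nat.descFactorial_zero, nsmul_eq_mul]
      refine Polynomial.funext fun z => ?_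
      simp
      ring
    push_cast at hx h
    -- in terms of the slacks `v` and `σ` of the two hypotheses all terms become nonnegative
    obtain ⟨v, hv⟩ : ∃ v, v = x - (k + 2) * α := ⟨_, rfl⟩
    have hv0 : 0 ≤ v := by rw [hv]; linarith
    obtain ⟨σ, hσ⟩ : ∃ σ, σ = v * (v + (k + 2 + κ) * α) - a := ⟨_, rfl⟩
    have hσ0 : 0 ≤ σ := by
      rw [hσ, hv]
      nlinarith
    have hxv : x = v + (k + 2) * α := by rw [hv]; ring
    have haσ : a = v * (v + (k + 2 + κ) * α) - σ := by rw [hσ]; ring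
    obtain ⟨t, ht⟩ : ∃ t, t = (x - α) * (x - α + κ * α) := ⟨_, rfl⟩
    obtain ⟨b, hb⟩ : ∃ b, b = α * (x - α + κ * α) := ⟨_, rfl⟩
    have hA : t - a = k * α * v + (k + 1) * (k + 1 + κ) * α ^ 2 + σ := by
      rw [ht, haσ, hxv]; ring
    have hApos : 0 < t - a := by rw [hA]; positivity
    have hbr : (t - a) * ((k + 2 + κ) * (t - a) + a * (k + 1)) -
        b * (k * ((k + 2 + κ) * (t - a) + a * (k + 1)) + (k + 2 + κ) * (t - a)) =
        (κ + 1) * σ ^ 2 + (2 * k * v * α * (k + 2 + κ) + (k + 1) * (k + 1 + κ) ^ 2 * α ^ 2 +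
          (k + 1) * v ^ 2) * σ + α ^ 2 * v ^ 2 * (κ + 1) := by
      rw [hb, ht, haσ, hxv]; ring
    have hbr0 : 0 ≤ (t - a) * ((k + 2 + κ) * (t - a) + a * (k + 1)) -
        b * (k * ((k + 2 + κ) * (t - a) + a * (k + 1)) + (k + 2 + κ) * (t - a)) := by
      rw [hbr]; positivity
    rw [← ht, ← hb]
    refine nonneg_of_mul_nonneg_right (a := t - a) ?_ hApos
    have hpow : (t - a) * ((k : ℝ) * (t - a) ^ (k - 1)) = k * (t - a) ^ k := by
      cases k with
      | zero => simp
      | succ k => simp [pow_succ]; ring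
    have hval : (t - a) * barrier t b (besselOp κ ((X - C a) ^ (k + 1 + 1))) =
        (k + 2) * (t - a) ^ k *
        ((t - a) * ((k + 2 + κ) * (t - a) + a * (k + 1)) -
        b * (k * ((k + 2 + κ) * (t - a) + a * (k + 1)) + (k + 2 + κ) * (t - a))) := by
      rw [hX, barrier_apply, derivative_C_mul, derivative_mul, derivative_X_sub_C_pow]
      simp
      linear_combination (-(k + 2) * b * ((k + 2 + κ) * (t - a) + a * (k + 1))) * hpow
    rw [hval]
    positivity

/-- The effect of `besselOp κ` on the barrier. -/
theorem barrier_besselOp {κ : ℕ} {α x : ℝ} (hα : 0 < α) (n : ℕ) (hx : n * α ≤ x)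
    (s : Multiset ℝ) (hcard : s.card = n)
    (hs : IsBelow s (x * (x + κ * α)) (α * (x + κ * α))) :
    0 ≤ barrier ((x - α) * (x - α + κ * α)) (α * (x - α + κ * α))
      (besselOp κ (rootPoly s)) := by
  induction n generalizing s with
  | zero =>
    rw [Multiset.card_eq_zero.1 hcard, rootPoly, Multiset.map_zero, Multiset.prod_zero,
      besselOp_apply]
    simp
  | succ n ih =>
    push_cast at hx
    refine nonneg_of_isBelow (barrier ((x - α) * (x - α + κ * α)) (α * (x - α + κ * α)) ∘ₗ
      besselOp κ) n ?_ ?_ s hcard hs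
    · intro s' hs' hb'
      exact ih (by linarith) s' hs' hb'
    · intro a _ _ hat
      exact barrier_besselOp_pow κ n hα hx hat

/-- `besselOp κ` moves the barrier from `x` to `x - α`. -/
theorem exists_isBelow_besselOp {κ : ℕ} {α x : ℝ} (hα : 0 < α) {n : ℕ} (hx : (n + 1) * α ≤ x)
    {s : Multiset ℝ} (hcard : s.card = n + 1)
    (hs : IsBelow s (x * (x + κ * α)) (α * (x + κ * α))) :
    ∃ s' : Multiset ℝ, s'.card = n ∧
      IsBelow s' ((x - α) * (x - α + κ * α)) (α * (x - α + κ * α)) ∧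
      besselOp κ (rootPoly s) = C ((n + 1) * (n + 1 + κ) : ℝ) * rootPoly s' := by
  obtain ⟨s', hcard', h0, heq⟩ := exists_besselOp_rootPoly κ n hcard hs.nonneg
  refine ⟨s', hcard', ?_, heq⟩
  have hκ : (0 : ℝ) ≤ κ := Nat.cast_nonneg κ
  rcases Nat.eq_zero_or_pos n with rfl | hn
  · rw [Multiset.card_eq_zero.1 hcard']
    exact ⟨by simp, by simp, by simp⟩
  have hn1 : (1 : ℝ) ≤ n := by exact_mod_cast hn
  have hxα : 0 < x - α := by nlinarith
  have hyα : 0 < x - α + κ * α := by positivity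
  have hc : (0 : ℝ) < (n + 1) * (n + 1 + κ) := by positivity
  -- the inequality at the dilate by `τ = c²` is the one for `c α` and `c x`
  have hbar : ∀ τ : ℝ, 1 ≤ τ → 0 ≤ barrier (τ * ((x - α) * (x - α + κ * α)))
      (τ * (α * (x - α + κ * α))) (rootPoly s') := by
    intro τ hτ
    obtain ⟨c, hc0, hcτ⟩ : ∃ c : ℝ, 0 < c ∧ τ = c * c :=
      ⟨√τ, Real.sqrt_pos.2 (by linarith), (Real.mul_self_sqrt (by linarith)).symm⟩
    have hdil := hs.dilate (by nlinarith) (by nlinarith) hτ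
    have h1 := barrier_besselOp (κ := κ) (α := c * α) (x := c * x) (by positivity) (n + 1)
      (by push_cast; nlinarith) s hcard (by convert hdil using 1 <;> rw [hcτ] <;> ring)
    rw [heq, ← smul_eq_C_mul, map_smul, smul_eq_mul] at h1
    have h2 := nonneg_of_mul_nonneg_right h1 hc
    rwa [show τ * ((x - α) * (x - α + κ * α)) =
      (c * x - c * α) * (c * x - c * α + κ * (c * α)) by rw [hcτ]; ring,
      show τ * (α * (x - α + κ * α)) = c * α * (c * x - c * α + κ * (c * α)) by rw [hcτ]; ring]
  have hlt := lt_of_barrier_nonneg (by positivity) (by positivity) hbar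
  refine isBelow_of_barrier_nonneg h0 hlt ?_
  simpa using hbar 1 le_rfl

/-- The barrier inequality for the convolution of two pure powers. -/
theorem barrier_besselConv_pow_pow {κ n : ℕ} {α x₁ x₂ a μ : ℝ} (hα : 0 < α)
    (h₁ : (n + 1) * α ≤ x₁) (h₂ : (n + 1) * α ≤ x₂) (ha : 0 ≤ a) (hμ : 0 ≤ μ)
    (hba : (n + 1) * (α * (x₁ + κ * α)) ≤ x₁ * (x₁ + κ * α) - a)
    (hbμ : (n + 1) * (α * (x₂ + κ * α)) ≤ x₂ * (x₂ + κ * α) - μ) :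
    0 ≤ barrier
      ((x₁ + x₂ - (n + 1) * α) * (x₁ + x₂ - (n + 1) * α + κ * α))
      (α * (x₁ + x₂ - (n + 1) * α + κ * α))
      (besselConv κ (n + 1) ((X - C a) ^ (n + 1)) ((X - C μ) ^ (n + 1))) := by
  have hκ : (0 : ℝ) ≤ κ := Nat.cast_nonneg κ
  obtain ⟨v₁, hv₁⟩ : ∃ v, v = x₁ - (n + 1) * α := ⟨_, rfl⟩
  obtain ⟨v₂, hv₂⟩ : ∃ v, v = x₂ - (n + 1) * α := ⟨_, rfl⟩
  have hv₁0 : 0 ≤ v₁ := by rw [hv₁]; linarith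
  have hv₂0 : 0 ≤ v₂ := by rw [hv₂]; linarith
  obtain rfl : x₁ = v₁ + (n + 1) * α := by rw [hv₁]; ring
  obtain rfl : x₂ = v₂ + (n + 1) * α := by rw [hv₂]; ring
  have ha1 : a ≤ v₁ * (v₁ + (n + 1 + κ) * α) := by linarith
  have hμ1 : μ ≤ v₂ * (v₂ + (n + 1 + κ) * α) := by linarith
  have hw : a * μ ≤ v₁ * (v₁ + (n + 1 + κ) * α) * (v₂ * (v₂ + (n + 1 + κ) * α)) :=
    mul_le_mul ha1 hμ1 hμ (by positivity)
  obtain ⟨x, hx⟩ : ∃ x, x = v₁ + (n + 1) * α + (v₂ + (n + 1) * α) - (n + 1) * α := ⟨_, rfl⟩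
  have hx' : x = v₁ + v₂ + (n + 1) * α := by rw [hx]; ring
  rw [← hx]
  have hY : 0 < α * (x + κ * α) := by rw [hx']; positivity
  have hg := gegen_barrier (κ := κ) (w := a * μ) (z := x * (x + κ * α) - (a + μ))
    (Y := α * (x + κ * α)) (s := v₁ * v₂) n (mul_nonneg ha hμ) hY (mul_nonneg hv₁0 hv₂0)
    (by rw [hx']; nlinarith) (by rw [hx']; linarith)
  rw [besselConv_pow_pow, ← smul_eq_C_mul, map_smul, smul_eq_mul, barrier_apply, derivative_comp]
  refine mul_nonneg (besselWeight_pos _ _).le ?_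
  simp only [eval_comp, eval_sub, eval_X, eval_C, derivative_sub, derivative_X,
    derivative_C, sub_zero, one_mul]
  linarith

/-- **Barrier theorem.** In the variables `x` and `y = x + κ α`, at which a polynomial `p` of degree
`n` is evaluated at `x y`, the barriers of two polynomials with nonnegative roots add up under
convolution, up to the shift by `n α`. -/
theorem barrier_besselConv {κ : ℕ} {α : ℝ} (hα : 0 < α) (n : ℕ) (x₁ x₂ : ℝ)
    (h₁ : n * α ≤ x₁) (h₂ : n * α ≤ x₂) (s₁ s₂ : Multiset ℝ) (hc₁ : s₁.card = n)
    (hc₂ : s₂.card = n)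
    (hs₁ : IsBelow s₁ (x₁ * (x₁ + κ * α)) (α * (x₁ + κ * α)))
    (hs₂ : IsBelow s₂ (x₂ * (x₂ + κ * α)) (α * (x₂ + κ * α))) :
    0 ≤ barrier ((x₁ + x₂ - n * α) * (x₁ + x₂ - n * α + κ * α))
      (α * (x₁ + x₂ - n * α + κ * α))
      (besselConv κ n (rootPoly s₁) (rootPoly s₂)) := by
  induction n generalizing x₁ x₂ s₁ s₂ with
  | zero =>
    rw [Multiset.card_eq_zero.1 hc₁, Multiset.card_eq_zero.1 hc₂, besselConv_apply]
    simp [rootPoly, barrier_apply]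
    exact (besselWeight_pos _ _).le
  | succ n ih =>
    push_cast at h₁ h₂ ⊢
    -- convolution with a polynomial of smaller degree
    have hlow : ∀ (x₁ x₂ : ℝ) (s₁ s₂ : Multiset ℝ), (n + 1) * α ≤ x₁ → (n + 1) * α ≤ x₂ →
        s₁.card = n → s₂.card = n + 1 →
        IsBelow s₁ (x₁ * (x₁ + κ * α)) (α * (x₁ + κ * α)) →
        IsBelow s₂ (x₂ * (x₂ + κ * α)) (α * (x₂ + κ * α)) →
        0 ≤ barrier ((x₁ + x₂ - (n + 1) * α) * (x₁ + x₂ - (n + 1) * α + κ * α))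
          (α * (x₁ + x₂ - (n + 1) * α + κ * α))
          (besselConv κ (n + 1) (rootPoly s₁) (rootPoly s₂)) := by
      intro x₁ x₂ s₁ s₂ h₁ h₂ hc₁ hc₂ hs₁ hs₂
      obtain ⟨s', hc', hs', heq⟩ := exists_isBelow_besselOp hα h₂ hc₂ hs₂
      have h := ih x₁ (x₂ - α) (by linarith) (by linarith) s₁ s' hc₁ hc' hs₁ hs'
      rw [besselConv_succ_of_natDegree_le (by rw [rootPoly_natDegree, hc₁]), heq,
        ← smul_eq_C_mul, map_smul, map_smul, smul_eq_mul]
      refine mul_nonneg (by positivity) ?_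
      rwa [show x₁ + (x₂ - α) - n * α = x₁ + x₂ - (n + 1) * α by ring] at h
    obtain ⟨ℓ, hℓ⟩ : ∃ ℓ, ℓ = barrier
        ((x₁ + x₂ - (n + 1) * α) * (x₁ + x₂ - (n + 1) * α + κ * α))
        (α * (x₁ + x₂ - (n + 1) * α + κ * α)) := ⟨_, rfl⟩
    have hdeg : ∀ s : Multiset ℝ, s.card ≤ n + 1 → (rootPoly s).natDegree ≤ n + 1 :=
      fun s hs => by rwa [rootPoly_natDegree]
    rw [← hℓ]
    refine nonneg_of_isBelow (ℓ ∘ₗ (besselConv κ (n + 1)).flip (rootPoly s₂)) n ?_ ?_ s₁ hc₁ hs₁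
    · intro s hc hs
      have := hlow x₁ x₂ s s₂ h₁ h₂ hc hc₂ hs hs₂
      rwa [← hℓ] at this
    · intro a ha0 hat hab
      have hrep := isBelow_replicate (n := n + 1) ha0 hat (by push_cast; exact hab)
      refine nonneg_of_isBelow (ℓ ∘ₗ besselConv κ (n + 1) ((X - C a) ^ (n + 1))) n ?_ ?_
        s₂ hc₂ hs₂
      · intro s hc hs
        have := hlow x₂ x₁ s _ h₂ h₁ hc (Multiset.card_replicate _ _) hs hrep
        rw [add_comm x₂ x₁, ← hℓ, besselConv_comm (hdeg s (by omega)) (hdeg _ (by simp)),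
          rootPoly_replicate] at this
        exact this
      · intro μ hμ0 _ hμb
        have := barrier_besselConv_pow_pow (κ := κ) hα h₁ h₂ ha0 hμ0 hab hμb
        rwa [← hℓ] at this

/-! ### Laguerre's theorem and bi-affine polynomials -/

/-- The set `{w | y |w|² + Im w ≤ 0}` is a disc through the origin: a quantitative form of the fact
that it contains the means of its elements. -/
theorem mul_normSq_sum_le {y : ℝ} (hy : 0 ≤ y) (s : Multiset ℂ)
    (h : ∀ w ∈ s, y * Complex.normSq w + w.im ≤ 0) :
    y * Complex.normSq s.sum + s.card * s.sum.im ≤ 0 := by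
  induction s using Multiset.induction with
  | empty => simp
  | cons w s ih =>
    have hw := h w (Multiset.mem_cons_self w s)
    have hs := ih fun v hv => h v (Multiset.mem_cons_of_mem hv)
    rcases Nat.eq_zero_or_pos s.card with h0 | hpos
    · rw [Multiset.card_eq_zero.1 h0]
      simpa using hw
    have hn : (0 : ℝ) < s.card := by exact_mod_cast hpos
    obtain ⟨n, hn'⟩ : ∃ n : ℝ, n = s.card := ⟨_, rfl⟩
    rw [Multiset.sum_cons, Multiset.card_cons]
    push_cast
    rw [← hn'] at hs hn ⊢
    obtain ⟨S, hS⟩ : ∃ S, S = s.sum := ⟨_, rfl⟩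
    rw [← hS] at hs ⊢
    refine nonpos_of_mul_nonpos_right (a := n) ?_ hn
    simp only [Complex.normSq_apply, Complex.add_re, Complex.add_im] at hs hw ⊢
    have h1 : 0 ≤ y * ((S.re - n * w.re) ^ 2 + (S.im - n * w.im) ^ 2) := by positivity
    have h2 := mul_nonneg (mul_nonneg hn.le (by linarith : 0 ≤ n + 1)) (neg_nonneg.2 hw)
    have h3 := mul_nonneg (by linarith : 0 ≤ n + 1) (neg_nonneg.2 hs)
    nlinarith

/-- **Laguerre's theorem** for the upper half plane: the polar derivative, with respect to a pole in
the half plane, of a polynomial without zeros there has no zeros there either. -/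
theorem polarDerivative_ne_zero {f : ℂ[X]} {k : ℕ} (hk : k ≠ 0) (hdeg : f.natDegree ≤ k)
    (hf : ∀ z : ℂ, 0 < z.im → f.eval z ≠ 0) {x ζ : ℂ} (hx : 0 < x.im) (hζ : 0 < ζ.im) :
    f.eval x + (ζ - x) / k * f.derivative.eval x ≠ 0 := by
  intro h0
  have hfx := hf x hx
  have hk0 : (k : ℂ) ≠ 0 := Nat.cast_ne_zero.2 hk
  have hkpos : (0 : ℝ) < k := by positivity
  have hlog := (IsAlgClosed.splits f).eval_derivative_div_eval_of_ne_zero hfx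
  obtain ⟨s, hs⟩ : ∃ s, s = f.roots.map fun r => 1 / (x - r) := ⟨_, rfl⟩
  rw [← hs] at hlog
  have hS : s.sum * (x - ζ) = k := by
    rw [← hlog]
    field_simp
    field_simp at h0
    linear_combination -h0
  -- the reciprocals `1 / (x - r)`, for `r` in the lower half plane, lie in a disc through `0`
  have hmem : ∀ w ∈ s, x.im * Complex.normSq w + w.im ≤ 0 := by
    intro w hw
    rw [hs] at hw
    obtain ⟨r, hr, rfl⟩ := Multiset.mem_map.1 hw
    have hr0 : f.eval r = 0 := ((mem_roots (fun h => by simp [h] at hfx)).1 hr)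
    have hri : r.im ≤ 0 := not_lt.1 fun h => hf r h hr0
    have hxr : x - r ≠ 0 := fun h => hfx (by rwa [sub_eq_zero.1 h])
    have hpos := Complex.normSq_pos.2 hxr
    rw [one_div, Complex.inv_im, Complex.normSq_inv, ← div_eq_mul_inv, ← add_div, Complex.sub_im]
    exact div_nonpos_of_nonpos_of_nonneg (by linarith) hpos.le
  have hsum := mul_normSq_sum_le hx.le s hmem
  have hcard : (s.card : ℝ) ≤ k := by
    rw [hs, Multiset.card_map]
    exact_mod_cast (card_roots' f).trans hdeg
  have hxζ : x - ζ ≠ 0 := fun h => hk0 (by rw [← hS, h, mul_zero])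
  have hSe : s.sum = k / (x - ζ) := by rw [eq_div_iff hxζ, hS]
  have hN := Complex.normSq_pos.2 hxζ
  have hSim : s.sum.im = k * (ζ.im - x.im) / Complex.normSq (x - ζ) := by
    rw [hSe, div_eq_mul_inv, Complex.mul_im, Complex.inv_im, Complex.sub_im, Complex.natCast_re,
      Complex.natCast_im]
    ring
  have hSn : Complex.normSq s.sum = k ^ 2 / Complex.normSq (x - ζ) := by
    rw [hSe, map_div₀, Complex.normSq_natCast, sq]
  rw [hSim, hSn, mul_div_assoc', mul_div_assoc', ← add_div] at hsum
  have h1 : x.im * (k : ℝ) ^ 2 + s.card * (k * (ζ.im - x.im)) ≤ 0 := by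
    by_contra hcon
    exact absurd hsum (not_le.2 (div_pos (not_le.1 hcon) hN))
  have h2 : 0 ≤ (k - s.card : ℝ) * (k * x.im) :=
    mul_nonneg (by linarith) (mul_pos hkpos hx).le
  have hc0 : s.card ≠ 0 := by
    intro h
    rw [Multiset.card_eq_zero.1 h, Multiset.sum_zero, zero_mul] at hS
    exact hk0 hS.symm
  have h3 : 0 < (s.card : ℝ) * (k * ζ.im) := by positivity
  nlinarith

/-- Subtracting a nonnegative multiple of the leading coefficient preserves the nonvanishing of a
bi-affine polynomial on the product of two upper half planes. -/
theorem biaffine_sub_ne_zero {a b c e : ℂ} {θ : ℝ} (hθ : 0 ≤ θ)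
    (h : ∀ ζ ω : ℂ, 0 < ζ.im → 0 < ω.im → a * ζ * ω + b * ζ + c * ω + e ≠ 0)
    {ζ ω : ℂ} (hζ : 0 < ζ.im) (hω : 0 < ω.im) :
    a * ζ * ω + b * ζ + c * ω + e - θ * a ≠ 0 := by
  rcases eq_or_ne a 0 with rfl | ha
  · simpa using h ζ ω hζ hω
  -- the pole of the Möbius map `ζ ↦ -(b ζ + e) / (a ζ + c)` is not in the upper half plane
  have hpole : 0 ≤ (c / a).im := by
    by_contra! hneg
    obtain ⟨K, hK⟩ : ∃ K, K = (e - b * c / a) / a := ⟨_, rfl⟩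
    have he : e = a * K + b * c / a := by rw [hK]; field_simp; ring
    have hζ0 : 0 < (-(c / a)).im := by rw [Complex.neg_im]; linarith
    rcases eq_or_ne K 0 with hK0 | hK0
    · refine h (-(c / a)) Complex.I hζ0 (by simp) ?_
      rw [he, hK0]
      field_simp
      ring
    -- near a pole in the half plane the Möbius map takes the value `s i - b / a`, for large `s`
    · obtain ⟨s, hs⟩ : ∃ s : ℝ, s = 1 + |(b / a).im| + ‖K‖ / (-(c / a)).im := ⟨_, rfl⟩
      have hKn : 0 < ‖K‖ := norm_pos_iff.2 hK0
      have hs0 : 0 < s := by rw [hs]; positivity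
      have hsC : (s : ℂ) ≠ 0 := Complex.ofReal_ne_zero.2 hs0.ne'
      refine h (-(c / a) + Complex.I * K / s) (s * Complex.I - b / a) ?_ ?_ ?_
      · have h1 : |(Complex.I * K / s).im| ≤ ‖K‖ / s := by
          refine (Complex.abs_im_le_norm _).trans ?_
          rw [norm_div, norm_mul, Complex.norm_I, one_mul, Complex.norm_real,
            Real.norm_of_nonneg hs0.le]
        have h2 : ‖K‖ / s < (-(c / a)).im := by
          rw [div_lt_iff₀ hs0, ← div_lt_iff₀' hζ0, hs]
          have := abs_nonneg (b / a).im
          linarith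
        rw [Complex.add_im]
        linarith [neg_abs_le (Complex.I * K / s).im]
      · rw [Complex.sub_im, Complex.im_ofReal_mul, Complex.I_im]
        have : 0 < ‖K‖ / (-(c / a)).im := by positivity
        linarith [le_abs_self (b / a).im]
      · rw [he]
        field_simp
        linear_combination (a ^ 2 * K * s) * Complex.I_sq
  intro h0
  obtain ⟨η, hη⟩ : ∃ η, η = ζ + c / a := ⟨_, rfl⟩
  have hηi : 0 < η.im := by rw [hη, Complex.add_im]; linarith
  have hη0 : η ≠ 0 := fun h => by simp [h] at hηi
  -- a zero `ω` of the modified polynomial would give the zero `ω - θ / η` of the original one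
  refine h ζ (ω - θ / η) hζ ?_ ?_
  · rw [Complex.sub_im, div_eq_mul_inv, Complex.im_ofReal_mul, Complex.inv_im]
    have : θ * (-η.im / Complex.normSq η) ≤ 0 :=
      mul_nonpos_of_nonneg_of_nonpos hθ
        (div_nonpos_of_nonpos_of_nonneg (by linarith) (Complex.normSq_nonneg η))
    linarith
  · have hc : c = a * η - a * ζ := by rw [hη]; field_simp; ring
    have hθη : a * η * (θ / η) = a * θ := by field_simp
    rw [hc] at h0 ⊢
    linear_combination h0 - hθη

/-! ### Polynomials in two variables without zeros in the upper half planes -/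

/-- The derivative, normalised for polynomials of degree at most `k + 1`. -/
noncomputable def scaledDeriv (k : ℕ) : ℂ[X] →ₗ[ℂ] ℂ[X] := ((k : ℂ) + 1)⁻¹ • derivative

/-- The polar derivative `f + (ζ - X) f' / (k + 1)` of polynomials of degree at most `k + 1` with
respect to the pole `ζ`. -/
noncomputable def polarDeriv (k : ℕ) (ζ : ℂ) : ℂ[X] →ₗ[ℂ] ℂ[X] :=
  LinearMap.id + LinearMap.mulLeft ℂ (C ζ - X) ∘ₗ scaledDeriv k

/-- A polynomial in two variables, of degree at most `k` in each of them and without zeros in the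
product of two upper half planes. It is encoded as the function `B` that sends a pair `φ`, `ψ` of
linear functionals on `ℂ[X]` to the value of `φ ⊗ ψ` at the polynomial. -/
structure IsStableKernel (k : ℕ) (B : Module.Dual ℂ ℂ[X] → Module.Dual ℂ ℂ[X] → ℂ) : Prop where
  right : ∀ φ, ∃ f : ℂ[X], f.natDegree ≤ k ∧ ∀ ψ, B φ ψ = ψ f
  left : ∀ ψ, ∃ f : ℂ[X], f.natDegree ≤ k ∧ ∀ φ, B φ ψ = φ f
  ne_zero : ∀ x y : ℂ, 0 < x.im → 0 < y.im → B (leval x) (leval y) ≠ 0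

/-- The operator `A ⊗ A - θ N ⊗ N` on polynomials in two variables, where `A` is the polar
derivative with respect to `z` and `N` the normalised derivative. -/
noncomputable def kernelStep (θ : ℝ) (z : ℂ) (k : ℕ)
    (B : Module.Dual ℂ ℂ[X] → Module.Dual ℂ ℂ[X] → ℂ)
    (φ ψ : Module.Dual ℂ ℂ[X]) : ℂ :=
  B (φ ∘ₗ polarDeriv k z) (ψ ∘ₗ polarDeriv k z) -
    θ * B (φ ∘ₗ scaledDeriv k) (ψ ∘ₗ scaledDeriv k)

/-- The `j`-th derivative at `z`, normalised for polynomials of degree at most `k`. -/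
noncomputable def derivAt (z : ℂ) (k j : ℕ) : Module.Dual ℂ ℂ[X] :=
  (((k - j).factorial : ℂ) / k.factorial) • (leval z ∘ₗ derivative ^ j)

/-- The value at `(z, z)` of `∑ⱼ C(k,j) ((k-j)!/k!)² (-θ)ʲ Dʲ ⊗ Dʲ` applied to a polynomial in two
variables. -/
noncomputable def kernelSum (θ : ℝ) (z : ℂ) (k : ℕ)
    (B : Module.Dual ℂ ℂ[X] → Module.Dual ℂ ℂ[X] → ℂ) : ℂ :=
  ∑ j ∈ Finset.range (k + 1), (k.choose j : ℂ) * ((-θ : ℂ) ^ j *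
    B (derivAt z k j) (derivAt z k j))

theorem scaledDeriv_apply (k : ℕ) (f : ℂ[X]) :
    scaledDeriv k f = ((k : ℂ) + 1)⁻¹ • derivative f := rfl

theorem polarDeriv_apply (k : ℕ) (ζ : ℂ) (f : ℂ[X]) :
    polarDeriv k ζ f = f + ((k : ℂ) + 1)⁻¹ • (ζ • derivative f - derivative f * X) := by
  simp only [polarDeriv, LinearMap.add_apply, LinearMap.comp_apply, LinearMap.id_apply,
    scaledDeriv_apply, LinearMap.mulLeft_apply, smul_eq_C_mul]
  ring

theorem natDegree_scaledDeriv_le {k : ℕ} {f : ℂ[X]} (hf : f.natDegree ≤ k + 1) :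
    (scaledDeriv k f).natDegree ≤ k :=
  (natDegree_smul_le _ _).trans ((natDegree_derivative_le f).trans (by omega))

theorem natDegree_polarDeriv_le {k : ℕ} (ζ : ℂ) {f : ℂ[X]} (hf : f.natDegree ≤ k + 1) :
    (polarDeriv k ζ f).natDegree ≤ k := by
  refine natDegree_le_iff_coeff_eq_zero.2 fun i hi => ?_
  obtain ⟨i, rfl⟩ : ∃ j, i = j + 1 := ⟨i - 1, by omega⟩
  have h2 : f.coeff (i + 1 + 1) = 0 := coeff_eq_zero_of_natDegree_lt (by omega)
  rw [polarDeriv_apply, coeff_add, coeff_smul, coeff_sub, coeff_smul, coeff_mul_X,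
    coeff_derivative, coeff_derivative, h2]
  simp only [smul_eq_mul]
  have hk : (k : ℂ) + 1 ≠ 0 := Nat.cast_add_one_ne_zero k
  rcases Nat.lt_or_ge k i with hki | hki
  · rw [coeff_eq_zero_of_natDegree_lt (p := f) (n := i + 1) (by omega)]
    simp
  · rw [show i = k by omega]
    field_simp
    ring

theorem derivAt_polarDeriv (z : ℂ) {k j : ℕ} (hj : j ≤ k) :
    derivAt z k j ∘ₗ polarDeriv k z = derivAt z (k + 1) j := by
  refine LinearMap.ext fun f => ?_
  have hk : (k : ℂ) + 1 ≠ 0 := Nat.cast_add_one_ne_zero k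
  have hkf : (k.factorial : ℂ) ≠ 0 := Nat.cast_ne_zero.2 k.factorial_ne_zero
  simp only [derivAt, LinearMap.comp_apply, LinearMap.smul_apply, polarDeriv_apply, map_add,
    map_smul, map_sub, Module.End.pow_apply, iterate_derivative_derivative_mul_X, leval_apply,
    ← Function.iterate_succ_apply, eval_mul, eval_X, nsmul_eq_mul, eval_natCast, smul_eq_mul]
  rw [show k + 1 - j = k - j + 1 by omega, Nat.factorial_succ, Nat.factorial_succ]
  push_cast [Nat.cast_sub hj]
  field_simp
  ring

theorem derivAt_scaledDeriv (z : ℂ) (k j : ℕ) :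
    derivAt z k j ∘ₗ scaledDeriv k = derivAt z (k + 1) (j + 1) := by
  refine LinearMap.ext fun f => ?_
  have hk : (k : ℂ) + 1 ≠ 0 := Nat.cast_add_one_ne_zero k
  have hkf : (k.factorial : ℂ) ≠ 0 := Nat.cast_ne_zero.2 k.factorial_ne_zero
  simp only [derivAt, LinearMap.comp_apply, LinearMap.smul_apply, scaledDeriv_apply,
    map_smul, Module.End.pow_apply, leval_apply, ← Function.iterate_succ_apply, smul_eq_mul]
  rw [show k + 1 - (j + 1) = k - j by omega, Nat.factorial_succ k]
  push_cast
  field_simp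

theorem kernelSum_kernelStep (θ : ℝ) (z : ℂ) (k : ℕ)
    (B : Module.Dual ℂ ℂ[X] → Module.Dual ℂ ℂ[X] → ℂ) :
    kernelSum θ z k (kernelStep θ z k B) = kernelSum θ z (k + 1) B := by
  have h := Finset.sum_choose_succ_mul (R := ℂ) (fun j _ => (-θ : ℂ) ^ j *
    B (derivAt z (k + 1) j) (derivAt z (k + 1) j)) k
  rw [kernelSum, kernelSum, h, ← Finset.sum_add_distrib]
  refine Finset.sum_congr rfl fun j hj => ?_
  rw [Finset.mem_range] at hj
  rw [kernelStep, derivAt_polarDeriv z (by omega), derivAt_scaledDeriv]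
  ring

theorem leval_polarDeriv (k : ℕ) (x ζ : ℂ) :
    leval x ∘ₗ polarDeriv k ζ =
      (leval x - x • (leval x ∘ₗ scaledDeriv k)) + ζ • (leval x ∘ₗ scaledDeriv k) := by
  refine LinearMap.ext fun f => ?_
  simp [polarDeriv_apply, scaledDeriv_apply, leval_apply]
  ring

theorem eval_polarDeriv_ne_zero {k : ℕ} {f : ℂ[X]} (hdeg : f.natDegree ≤ k + 1)
    (hf : ∀ z : ℂ, 0 < z.im → f.eval z ≠ 0) {x ζ : ℂ} (hx : 0 < x.im) (hζ : 0 < ζ.im) :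
    (polarDeriv k ζ f).eval x ≠ 0 := by
  have h := polarDerivative_ne_zero k.succ_ne_zero hdeg hf hx hζ
  convert h using 1
  rw [polarDeriv_apply]
  simp
  ring

theorem IsStableKernel.kernelStep {θ : ℝ} (hθ : 0 ≤ θ) {z : ℂ} (hz : 0 < z.im) {k : ℕ}
    {B : Module.Dual ℂ ℂ[X] → Module.Dual ℂ ℂ[X] → ℂ} (hB : IsStableKernel (k + 1) B) :
    IsStableKernel k (kernelStep θ z k B) := by
  have hdeg : ∀ f g : ℂ[X], f.natDegree ≤ k + 1 → g.natDegree ≤ k + 1 →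
      (polarDeriv k z f - (θ : ℂ) • scaledDeriv k g).natDegree ≤ k := fun f g hf hg =>
    (natDegree_sub_le _ _).trans (max_le (natDegree_polarDeriv_le z hf)
      ((natDegree_smul_le _ _).trans (natDegree_scaledDeriv_le hg)))
  refine ⟨fun φ => ?_, fun ψ => ?_, fun x y hx hy => ?_⟩
  · obtain ⟨f, hf, hf'⟩ := hB.right (φ ∘ₗ polarDeriv k z)
    obtain ⟨g, hg, hg'⟩ := hB.right (φ ∘ₗ scaledDeriv k)
    exact ⟨_, hdeg f g hf hg, fun ψ => by simp [_root_.kernelStep, hf', hg']⟩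
  · obtain ⟨f, hf, hf'⟩ := hB.left (ψ ∘ₗ polarDeriv k z)
    obtain ⟨g, hg, hg'⟩ := hB.left (ψ ∘ₗ scaledDeriv k)
    exact ⟨_, hdeg f g hf hg, fun φ => by simp [_root_.kernelStep, hf', hg']⟩
  · -- Laguerre's theorem in each variable, with independent poles
    have hpolar : ∀ ζ ω : ℂ, 0 < ζ.im → 0 < ω.im →
        B (leval x ∘ₗ polarDeriv k ζ) (leval y ∘ₗ polarDeriv k ω) ≠ 0 := by
      intro ζ ω hζ hω
      have h1 : ∀ y : ℂ, 0 < y.im → B (leval x ∘ₗ polarDeriv k ζ) (leval y) ≠ 0 := by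
        intro y hy
        obtain ⟨f, hf, hf'⟩ := hB.left (leval y)
        rw [hf']
        exact eval_polarDeriv_ne_zero hf
          (fun w hw => by rw [← leval_apply, ← hf']; exact hB.ne_zero w y hw hy) hx hζ
      obtain ⟨f, hf, hf'⟩ := hB.right (leval x ∘ₗ polarDeriv k ζ)
      rw [hf']
      exact eval_polarDeriv_ne_zero hf
        (fun w hw => by rw [← leval_apply, ← hf']; exact h1 w hw) hy hω
    have hadd : ∀ (φ φ' : Module.Dual ℂ ℂ[X]) (c : ℂ) ψ,
        B (φ + c • φ') ψ = B φ ψ + c * B φ' ψ := by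
      intro φ φ' c ψ
      obtain ⟨f, -, hf⟩ := hB.left ψ
      simp [hf]
    have hadd' : ∀ (φ ψ ψ' : Module.Dual ℂ ℂ[X]) (c : ℂ),
        B φ (ψ + c • ψ') = B φ ψ + c * B φ ψ' := by
      intro φ ψ ψ' c
      obtain ⟨f, -, hf⟩ := hB.right φ
      simp [hf]
    simp only [leval_polarDeriv, hadd, hadd'] at hpolar
    rw [_root_.kernelStep, leval_polarDeriv, leval_polarDeriv]
    simp only [hadd, hadd']
    obtain ⟨U, hU⟩ : ∃ U, U = leval x - x • (leval x ∘ₗ scaledDeriv k) := ⟨_, rfl⟩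
    obtain ⟨V, hV⟩ : ∃ V, V = leval y - y • (leval y ∘ₗ scaledDeriv k) := ⟨_, rfl⟩
    rw [← hU, ← hV] at hpolar ⊢
    have := biaffine_sub_ne_zero (a := B (leval x ∘ₗ scaledDeriv k) (leval y ∘ₗ scaledDeriv k))
      (b := B (leval x ∘ₗ scaledDeriv k) V) (c := B U (leval y ∘ₗ scaledDeriv k))
      (e := B U V) hθ (fun ζ ω hζ hω => by
        convert hpolar ζ ω hζ hω using 1
        ring) hz hz
    convert this using 1
    ring

theorem IsStableKernel.kernelSum_ne_zero {θ : ℝ} (hθ : 0 ≤ θ) {z : ℂ} (hz : 0 < z.im) {k : ℕ}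
    {B : Module.Dual ℂ ℂ[X] → Module.Dual ℂ ℂ[X] → ℂ} (hB : IsStableKernel k B) :
    kernelSum θ z k B ≠ 0 := by
  induction k generalizing B with
  | zero =>
    have : derivAt z 0 0 = leval z := by
      refine LinearMap.ext fun f => ?_
      simp [derivAt]
    simpa [kernelSum, this] using hB.ne_zero z z hz hz
  | succ k ih =>
    rw [← kernelSum_kernelStep]
    exact ih (hB.kernelStep hθ hz)

/-! ### Real-rootedness of the convolution with a pure power -/

/-- The polynomial `y^κ p(x y)` in two variables, for `p` of degree at most `n`. -/
noncomputable def productKernel (κ n : ℕ) (p : ℝ[X]) (φ ψ : Module.Dual ℂ ℂ[X]) : ℂ :=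
  ∑ a ∈ Finset.range (n + 1), (p.coeff a : ℂ) * (φ (X ^ a) * ψ (X ^ (a + κ)))

theorem mul_ne_ofReal_of_im_pos {x y : ℂ} (hx : 0 < x.im) (hy : 0 < y.im) {r : ℝ} (hr : 0 ≤ r) :
    x * y ≠ r := by
  intro h
  have hy0 : y ≠ 0 := fun h => by simp [h] at hy
  have hxe : x = r * y⁻¹ := by rw [← h]; field_simp
  rw [hxe, Complex.im_ofReal_mul, Complex.inv_im] at hx
  have : r * (-y.im / Complex.normSq y) ≤ 0 :=
    mul_nonpos_of_nonneg_of_nonpos hr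
      (div_nonpos_of_nonpos_of_nonneg (by linarith) (Complex.normSq_nonneg y))
  linarith

theorem isStableKernel_productKernel {κ n : ℕ} {s : Multiset ℝ} (hcard : s.card = n)
    (hs : ∀ r ∈ s, 0 ≤ r) : IsStableKernel (n + κ) (productKernel κ n (rootPoly s)) := by
  refine ⟨fun φ => ⟨∑ a ∈ Finset.range (n + 1),
      ((rootPoly s).coeff a * φ (X ^ a) : ℂ) • (X : ℂ[X]) ^ (a + κ), ?_, fun ψ => ?_⟩,
    fun ψ => ⟨∑ a ∈ Finset.range (n + 1),
      ((rootPoly s).coeff a * ψ (X ^ (a + κ)) : ℂ) • (X : ℂ[X]) ^ a, ?_, fun φ => ?_⟩,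
    fun x y hx hy => ?_⟩
  · refine natDegree_sum_le_of_forall_le _ _ fun a ha => ?_
    rw [Finset.mem_range] at ha
    exact (natDegree_smul_le _ _).trans (by rw [natDegree_X_pow]; omega)
  · simp [productKernel, mul_assoc]
  · refine natDegree_sum_le_of_forall_le _ _ fun a ha => ?_
    rw [Finset.mem_range] at ha
    exact (natDegree_smul_le _ _).trans (by rw [natDegree_X_pow]; omega)
  · simp [productKernel, mul_assoc, mul_comm (ψ _)]
  · have hval : productKernel κ n (rootPoly s) (leval x) (leval y) =
        y ^ κ * aeval (x * y) (rootPoly s) := by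
      rw [aeval_eq_sum_range, rootPoly_natDegree, hcard, productKernel, Finset.mul_sum]
      refine Finset.sum_congr rfl fun a _ => ?_
      simp only [leval_apply, eval_pow, eval_X, Complex.real_smul]
      ring
    have hy0 : y ≠ 0 := fun h => by simp [h] at hy
    rw [hval, rootPoly, map_multiset_prod]
    refine mul_ne_zero (pow_ne_zero _ hy0) (Multiset.prod_ne_zero fun h => ?_)
    rw [Multiset.map_map] at h
    obtain ⟨r, hr, h⟩ := Multiset.mem_map.1 h
    refine mul_ne_ofReal_of_im_pos hx hy (hs r hr) ?_
    simpa [sub_eq_zero] using h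

theorem besselOp_pow_X_pow (κ i a : ℕ) :
    (besselOp κ ^ i) (X ^ a) =
      C ((a.descFactorial i : ℝ) * (a + κ).descFactorial i) * X ^ (a - i) := by
  induction i generalizing a with
  | zero => simp
  | succ i ih =>
    have h1 : besselOp κ (X ^ a) = ((a : ℝ) * (a + κ)) • (X : ℝ[X]) ^ (a - 1) := by
      ext k
      rw [coeff_besselOp, coeff_X_pow, coeff_smul, coeff_X_pow]
      rcases Nat.eq_zero_or_pos a with rfl | ha
      · simp
      · by_cases hk : k + 1 = a
        · rw [if_pos hk, if_pos (by omega), ← hk]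
          push_cast
          simp
        · rw [if_neg hk, if_neg (by omega)]
          simp
    rw [pow_succ, Module.End.mul_apply, h1, map_smul, ih, smul_eq_C_mul, ← mul_assoc, ← C_mul]
    rcases Nat.eq_zero_or_pos a with rfl | ha
    · simp
    · obtain ⟨a, rfl⟩ : ∃ b, a = b + 1 := ⟨a - 1, by omega⟩
      rw [show a + 1 + κ = a + κ + 1 by ring, Nat.succ_descFactorial_succ,
        Nat.succ_descFactorial_succ, show a + 1 - 1 = a by omega,
        show a + 1 - (i + 1) = a - i by omega]
      push_cast
      congr 2
      ring

theorem derivAt_X_pow (z : ℂ) (k j a : ℕ) :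
    derivAt z k j (X ^ a) =
      ((k - j).factorial : ℂ) / k.factorial * (a.descFactorial j * z ^ (a - j)) := by
  simp only [derivAt, LinearMap.smul_apply, LinearMap.comp_apply, Module.End.pow_apply,
    iterate_derivative_X_pow_eq_natCast_mul, leval_apply, smul_eq_mul]
  simp

/-- The convolution with `(x - θ)^n`, evaluated at `z²`, is the sum `kernelSum` of the polynomial
`y^κ p(x y)`, up to the factor `z^κ`. -/
theorem kernelSum_productKernel (κ n : ℕ) (θ : ℝ) (z : ℂ) {p : ℝ[X]} (hp : p.natDegree ≤ n) :
    kernelSum θ z (n + κ) (productKernel κ n p) =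
      z ^ κ * aeval (z ^ 2) (rectConv (n + κ) n p ((X - C θ) ^ n)) := by
  have hq : ((X - C θ) ^ n).natDegree ≤ n := by simp
  have hpsum : p = ∑ a ∈ Finset.range (n + 1), C (p.coeff a) * X ^ a :=
    as_sum_range_C_mul_X_pow' p (by omega)
  have hw := (besselWeight_pos κ n).ne'
  have hR : rectConv (n + κ) n p ((X - C θ) ^ n) =
      ∑ i ∈ Finset.range (n + 1), ∑ a ∈ Finset.range (n + 1),
        C (besselWeight κ (n - i) / besselWeight κ n * ((n.choose i : ℝ) * (-θ) ^ i) *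
          p.coeff a * ((a.descFactorial i : ℝ) * (a + κ).descFactorial i)) * X ^ (a - i) := by
    rw [rectConv_eq_besselConv κ n p hq, besselConv_comm hp hq, besselConv_apply, Finset.smul_sum]
    refine Finset.sum_congr rfl fun i hi => ?_
    rw [Finset.mem_range] at hi
    conv_lhs => rw [hpsum]
    simp only [← smul_eq_C_mul, map_sum, map_smul, besselOp_pow_X_pow, Finset.smul_sum, smul_smul]
    refine Finset.sum_congr rfl fun a _ => ?_
    rw [smul_eq_C_mul, smul_eq_C_mul, sub_eq_add_neg, ← C_neg, coeff_X_add_C_pow,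
      show n - (n - i) = i by omega, Nat.choose_symm (by omega)]
    congr 2
    ring
  rw [hR, kernelSum]
  simp only [map_sum, map_mul, aeval_C, map_pow, aeval_X, Finset.mul_sum]
  symm
  refine (Finset.sum_subset (Finset.range_subset_range.2 (by omega : n + 1 ≤ n + κ + 1))
    fun i _ hi => ?_).trans (Finset.sum_congr rfl fun i hi => ?_)
  · rw [Finset.mem_range] at hi
    refine Finset.sum_eq_zero fun a ha => ?_
    rw [Finset.mem_range] at ha
    rw [Nat.descFactorial_of_lt (show a < i by omega)]
    simp
  · rw [productKernel, Finset.mul_sum, Finset.mul_sum]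
    refine Finset.sum_congr rfl fun a ha => ?_
    rw [Finset.mem_range] at ha hi
    rw [derivAt_X_pow, derivAt_X_pow]
    rcases lt_or_ge a i with hai | hai
    · rw [Nat.descFactorial_of_lt hai]
      simp
    · obtain ⟨c, rfl⟩ : ∃ c, a = i + c := ⟨a - i, by omega⟩
      obtain ⟨l, rfl⟩ : ∃ l, n = i + l := ⟨n - i, by omega⟩
      rw [show i + c - i = c by omega, show i + c + κ - i = c + κ by omega,
        show i + l - i = l by omega, Nat.cast_choose ℂ (by omega : i ≤ i + l + κ),
        Nat.cast_choose ℝ (by omega : i ≤ i + l), show i + l + κ - i = l + κ by omega,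
        show i + l - i = l by omega]
      simp only [besselWeight, Complex.coe_algebraMap]
      push_cast
      have h1 : ((i + l).factorial : ℂ) ≠ 0 := Nat.cast_ne_zero.2 (Nat.factorial_ne_zero _)
      have h2 : ((i + l + κ).factorial : ℂ) ≠ 0 := Nat.cast_ne_zero.2 (Nat.factorial_ne_zero _)
      have h3 : (l.factorial : ℂ) ≠ 0 := Nat.cast_ne_zero.2 (Nat.factorial_ne_zero _)
      have h4 : ((l + κ).factorial : ℂ) ≠ 0 := Nat.cast_ne_zero.2 (Nat.factorial_ne_zero _)
      have h5 : (i.factorial : ℂ) ≠ 0 := Nat.cast_ne_zero.2 (Nat.factorial_ne_zero _)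
      field_simp
      ring

theorem rectConv_pow_monic {κ n : ℕ} {θ : ℝ} {s : Multiset ℝ} (hcard : s.card = n) :
    (rectConv (n + κ) n (rootPoly s) ((X - C θ) ^ n)).Monic ∧
      (rectConv (n + κ) n (rootPoly s) ((X - C θ) ^ n)).natDegree = n := by
  have hq : ((X - C θ) ^ n).natDegree ≤ n := by simp
  have hqc : ((X - C θ) ^ n).coeff n = 1 := by
    have := (monic_X_sub_C θ).pow n
    rwa [Monic, leadingCoeff, natDegree_pow, natDegree_X_sub_C, mul_one] at this
  have hpc : (rootPoly s).coeff n = 1 := by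
    have := rootPoly_monic s
    rwa [Monic, leadingCoeff, rootPoly_natDegree, hcard] at this
  have hw := (besselWeight_pos κ n).ne'
  have hle : (rectConv (n + κ) n (rootPoly s) ((X - C θ) ^ n)).natDegree ≤ n :=
    natDegree_le_iff_coeff_eq_zero.2 fun _ hk => rectConv_coeff_of_lt hk _ _
  have hc : (rectConv (n + κ) n (rootPoly s) ((X - C θ) ^ n)).coeff n = 1 := by
    have h := coeff_besselConv_of_le (κ := κ) le_rfl (rootPoly s) hq
    rw [Nat.sub_self, Finset.sum_range_one, Nat.sub_zero, Nat.add_zero, hpc, hqc, mul_one] at h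
    rw [rectConv_eq_besselConv κ n _ hq, coeff_smul, smul_eq_mul, mul_left_cancel₀ hw h,
      inv_mul_cancel₀ hw]
  exact ⟨monic_of_natDegree_le_of_coeff_eq_one n hle hc,
    le_antisymm hle (le_natDegree_of_ne_zero (by rw [hc]; exact one_ne_zero))⟩

/-- Convolution with `(x - θ)^n`, where `0 ≤ θ`, preserves the monic polynomials of degree `n` with
nonnegative real roots. -/
theorem exists_rectConv_pow_eq_rootPoly {κ n : ℕ} {θ : ℝ} (hθ : 0 ≤ θ) {s : Multiset ℝ}
    (hcard : s.card = n) (hs : ∀ r ∈ s, 0 ≤ r) :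
    ∃ s' : Multiset ℝ, s'.card = n ∧ (∀ r ∈ s', 0 ≤ r) ∧
      rectConv (n + κ) n (rootPoly s) ((X - C θ) ^ n) = rootPoly s' := by
  obtain ⟨hmonic, hdeg⟩ := rectConv_pow_monic (κ := κ) (θ := θ) hcard
  have hsum := fun z : ℂ => kernelSum_productKernel κ n θ z (p := rootPoly s)
    (by rw [rootPoly_natDegree, hcard])
  obtain ⟨R, hR⟩ : ∃ R, R = rectConv (n + κ) n (rootPoly s) ((X - C θ) ^ n) := ⟨_, rfl⟩
  rw [← hR] at hmonic hdeg hsum ⊢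
  -- every complex root is the square of a number that is not in the upper half plane
  have hroot : ∀ w : ℂ, aeval w R = 0 → ∃ r : ℝ, 0 ≤ r ∧ w = r := by
    intro w hw
    obtain ⟨z, hz⟩ : ∃ z : ℂ, z ^ 2 = w := IsAlgClosed.exists_pow_nat_eq w two_pos
    have hzi : z.im = 0 := by
      have key : ∀ v : ℂ, v ^ 2 = w → ¬ 0 < v.im := by
        intro v hv hvi
        refine (isStableKernel_productKernel (κ := κ) hcard hs).kernelSum_ne_zero hθ hvi ?_
        rw [hsum, hv, hw, mul_zero]
      have h1 := key z hz
      have h2 := key (-z) (by rw [neg_sq, hz])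
      rw [Complex.neg_im] at h2
      linarith
    refine ⟨z.re ^ 2, sq_nonneg _, ?_⟩
    rw [← hz]
    apply Complex.ext <;> simp [sq, hzi]
  have hsplits : R.Splits := by
    refine Splits.of_splits_map (algebraMap ℝ ℂ) (IsAlgClosed.splits _) fun w hw => ?_
    obtain ⟨r, -, rfl⟩ := hroot w (by
      rw [aeval_def, ← eval_map]
      exact isRoot_of_mem_roots hw)
    exact ⟨r, rfl⟩
  refine ⟨R.roots, ?_, fun r hr => ?_, ?_⟩
  · rw [splits_iff_card_roots.1 hsplits, hdeg]
  · obtain ⟨r', hr', h⟩ := hroot r (by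
      rw [← Complex.coe_algebraMap, aeval_algebraMap_apply, coe_aeval_eq_eval,
        (isRoot_of_mem_roots hr).eq_zero, map_zero])
    rwa [Complex.ofReal_inj.1 h]
  · have := hsplits.eq_prod_roots
    rwa [hmonic.leadingCoeff, C_1, one_mul] at this

/-! ### Iterated convolution and the largest root -/

/-- Convolution with `(x - θ)^n` moves the point `x` at which a multiset of roots is below the
barrier by `δ`, where `θ = δ (δ + (n + κ) α)`. -/
theorem IsBelow.rectConv_pow {κ n : ℕ} {α δ θ x : ℝ} (hn : 1 ≤ n) (hα : 0 < α) (hδ : 0 ≤ δ)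
    (hθ : 0 ≤ θ) (hδθ : δ * (δ + (n + κ) * α) = θ) (hx : n * α ≤ x) {s s' : Multiset ℝ}
    (hcard : s.card = n) (hs : IsBelow s (x * (x + κ * α)) (α * (x + κ * α)))
    (h0 : ∀ r ∈ s', 0 ≤ r)
    (heq : rectConv (n + κ) n (rootPoly s) ((X - C θ) ^ n) = rootPoly s') :
    IsBelow s' ((x + δ) * (x + δ + κ * α)) (α * (x + δ + κ * α)) := by
  have hn' : (1 : ℝ) ≤ n := by exact_mod_cast hn
  have hκ : (0 : ℝ) ≤ κ := Nat.cast_nonneg κ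
  have hnα : 0 < n * α := by positivity
  have hx0 : 0 < x := by linarith
  obtain ⟨x₂, hx₂⟩ : ∃ x₂, x₂ = n * α + δ := ⟨_, rfl⟩
  have hx₂0 : 0 < x₂ := by linarith
  have hpow : IsBelow (Multiset.replicate n θ) (x₂ * (x₂ + κ * α)) (α * (x₂ + κ * α)) := by
    have h : n * (α * (x₂ + κ * α)) = x₂ * (x₂ + κ * α) - θ := by rw [← hδθ, hx₂]; ring
    have hpos : 0 < n * (α * (x₂ + κ * α)) := by positivity
    exact isBelow_replicate hθ (by linarith) h.le
  -- the inequality at the dilate by `τ = c²` is the one for `c α` and `c x`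
  have hbar : ∀ τ : ℝ, 1 ≤ τ → 0 ≤ barrier (τ * ((x + δ) * (x + δ + κ * α)))
      (τ * (α * (x + δ + κ * α))) (rootPoly s') := by
    intro τ hτ
    obtain ⟨c, hc0, hcτ⟩ : ∃ c : ℝ, 0 < c ∧ τ = c * c :=
      ⟨√τ, Real.sqrt_pos.2 (by linarith), (Real.mul_self_sqrt (by linarith)).symm⟩
    have h₁ := hs.dilate (by positivity) (by positivity) hτ
    have h₂ := hpow.dilate (by positivity) (by positivity) hτ
    have h := barrier_besselConv (κ := κ) (α := c * α) (by positivity) n (c * x) (c * x₂)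
      (by nlinarith) (by nlinarith) s (Multiset.replicate n θ) hcard
      (Multiset.card_replicate _ _)
      (by convert h₁ using 1 <;> rw [hcτ] <;> ring) (by convert h₂ using 1 <;> rw [hcτ] <;> ring)
    rw [rootPoly_replicate] at h
    rw [← heq, rectConv_eq_besselConv κ n _ (by simp), map_smul, smul_eq_mul]
    refine mul_nonneg (inv_nonneg.2 (besselWeight_pos κ n).le) ?_
    have hpt : c * x + c * x₂ - n * (c * α) = c * (x + δ) := by rw [hx₂]; ring
    rw [hpt] at h
    rwa [show τ * ((x + δ) * (x + δ + κ * α)) = c * (x + δ) * (c * (x + δ) + κ * (c * α)) by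
      rw [hcτ]; ring,
      show τ * (α * (x + δ + κ * α)) = c * α * (c * (x + δ) + κ * (c * α)) by rw [hcτ]; ring]
  refine isBelow_of_barrier_nonneg h0 (lt_of_barrier_nonneg (by positivity) (by positivity) hbar) ?_
  simpa using hbar 1 le_rfl

/-- The roots of the iterated convolution of `(x - θ)^n`: they are nonnegative, and they are below
the barrier at the point `n α + d δ`. -/
theorem exists_rectConvPow_eq_rootPoly (κ : ℕ) {n : ℕ} (hn : 1 ≤ n) {θ : ℝ} (hθ : 0 ≤ θ) (d : ℕ) :
    ∃ s : Multiset ℝ, s.card = n ∧ (∀ r ∈ s, 0 ≤ r) ∧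
      rectConvPow (n + κ) n ((X - C θ) ^ n) (d + 1) = rootPoly s ∧
      ∀ α δ : ℝ, 0 < α → 0 ≤ δ → δ * (δ + (n + κ) * α) = θ →
        IsBelow s ((n * α + (d + 1) * δ) * (n * α + (d + 1) * δ + κ * α))
          (α * (n * α + (d + 1) * δ + κ * α)) := by
  have hn' : (1 : ℝ) ≤ n := by exact_mod_cast hn
  have hκ : (0 : ℝ) ≤ κ := Nat.cast_nonneg κ
  induction d with
  | zero =>
    refine ⟨Multiset.replicate n θ, Multiset.card_replicate _ _,
      fun r hr => (Multiset.eq_of_mem_replicate hr) ▸ hθ, (rootPoly_replicate n θ).symm,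
      fun α δ hα hδ hδθ => ?_⟩
    push_cast
    have h : n * (α * (n * α + (0 + 1) * δ + κ * α)) =
        (n * α + (0 + 1) * δ) * (n * α + (0 + 1) * δ + κ * α) - θ := by rw [← hδθ]; ring
    have hpos : 0 < n * (α * (n * α + (0 + 1) * δ + κ * α)) := by positivity
    exact isBelow_replicate hθ (by linarith) h.le
  | succ d ih =>
    obtain ⟨s, hcard, hs, heq, hbelow⟩ := ih
    obtain ⟨s', hcard', hs', heq'⟩ := exists_rectConv_pow_eq_rootPoly (κ := κ) hθ hcard hs
    refine ⟨s', hcard', hs', ?_, fun α δ hα hδ hδθ => ?_⟩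
    · rw [rectConvPow, heq, heq']
    · have h := (hbelow α δ hα hδ hδθ).rectConv_pow hn hα hδ hθ hδθ
        (le_add_of_nonneg_right (by positivity)) hcard hs' heq'
      push_cast
      rwa [show n * α + (d + 1) * δ + δ = n * α + (d + 1 + 1) * δ by ring] at h

theorem isLargestRoot_squareSubst_rootPoly {s : Multiset ℝ} (hs : ∀ r ∈ s, 0 ≤ r) {r : ℝ}
    (hr : r ∈ s) (hmax : ∀ r' ∈ s, r' ≤ r) : IsLargestRoot (squareSubst (rootPoly s)) √r := by
  have hroot : ∀ x : ℝ, (squareSubst (rootPoly s)).IsRoot x ↔ x ^ 2 ∈ s := by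
    intro x
    rw [squareSubst, IsRoot, eval_comp, eval_pow, eval_X, ← IsRoot.def,
      ← mem_roots (rootPoly_monic s).ne_zero, rootPoly_roots]
  refine ⟨?_, ?_, ?_, ?_⟩
  · exact ((rootPoly_monic s).comp (monic_X_pow 2) (by simp)).ne_zero
  · rw [squareSubst, rootPoly, multiset_prod_comp, Multiset.map_map]
    refine Splits.multisetProd fun f hf => ?_
    obtain ⟨a, ha, rfl⟩ := Multiset.mem_map.1 hf
    have : (X - C a).comp (X ^ 2) = (X - C √a) * (X + C √a) := by
      rw [sub_comp, X_comp, C_comp]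
      conv_lhs => rw [← Real.sq_sqrt (hs a ha), C_pow]
      ring
    rw [Function.comp_apply, this]
    exact (Splits.X_sub_C _).mul (Splits.X_add_C _)
  · rw [Set.mem_ofPred_eq, hroot, Real.sq_sqrt (hs r hr)]
    exact hr
  · intro x hx
    exact Real.le_sqrt_of_sq_le (hmax _ ((hroot x).1 hx))

theorem proposition3p1 (u θ : ℝ) (hu : 0 ≤ u) (hθ : 0 ≤ θ) (m n d : ℕ)
    (hn : 1 ≤ n) (hmn : n ≤ m) (hd : 1 ≤ d) :
    ∃ lam : ℝ, IsLargestRoot (qPoly θ m n d) lam ∧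
      lam ^ 2 ≤ ((d : ℝ) * √(θ + (m : ℝ) ^ 2 * u ^ 2) - (d : ℝ) * (m : ℝ) * u
          + ((m : ℝ) + (n : ℝ)) * u) ^ 2 - ((m : ℝ) - (n : ℝ)) ^ 2 * u ^ 2 := by
  obtain ⟨κ, rfl⟩ := Nat.exists_eq_add_of_le hmn
  obtain ⟨d, rfl⟩ : ∃ e, d = e + 1 := ⟨d - 1, by omega⟩
  obtain ⟨s, hcard, hs, heq, hbelow⟩ := exists_rectConvPow_eq_rootPoly κ hn hθ d
  obtain ⟨r, hr, hmax⟩ : ∃ r ∈ s, ∀ r' ∈ s, r' ≤ r := by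
    have hne : s.toFinset.Nonempty := by
      rw [Multiset.toFinset_nonempty]
      rintro rfl
      simp at hcard
      omega
    refine ⟨s.toFinset.max' hne, Multiset.mem_toFinset.1 (Finset.max'_mem _ _), fun r' hr' =>
      Finset.le_max' _ _ (Multiset.mem_toFinset.2 hr')⟩
  refine ⟨√r, ?_, ?_⟩
  · rw [qPoly, heq]
    exact isLargestRoot_squareSubst_rootPoly hs hr hmax
  rw [Real.sq_sqrt (hs r hr)]
  -- the roots do not depend on `u`, so that the case `u = 0` follows by continuity
  have hclosed : IsClosed {u : ℝ | r ≤ (((d + 1 : ℕ) : ℝ) * √(θ + ((n + κ : ℕ) : ℝ) ^ 2 * u ^ 2) -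
      ((d + 1 : ℕ) : ℝ) * ((n + κ : ℕ) : ℝ) * u + (((n + κ : ℕ) : ℝ) + n) * u) ^ 2 -
      (((n + κ : ℕ) : ℝ) - n) ^ 2 * u ^ 2} :=
    isClosed_le continuous_const (by fun_prop)
  refine closure_minimal ?_ hclosed (show u ∈ closure (Set.Ioi (0 : ℝ)) by
    rw [closure_Ioi]; exact hu)
  intro v hv
  rw [Set.mem_Ioi] at hv
  obtain ⟨w, hw⟩ : ∃ w, w = √(θ + ((n + κ : ℕ) : ℝ) ^ 2 * v ^ 2) := ⟨_, rfl⟩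
  have hw2 : w ^ 2 = θ + ((n + κ : ℕ) : ℝ) ^ 2 * v ^ 2 := by
    rw [hw, Real.sq_sqrt (by positivity)]
  have hwge : ((n + κ : ℕ) : ℝ) * v ≤ w := by
    rw [hw]
    exact Real.le_sqrt_of_sq_le (by rw [mul_pow]; linarith)
  rw [Set.mem_ofPred_eq, ← hw]
  push_cast at hw2 hwge ⊢
  have h := (hbelow (2 * v) (w - (n + κ) * v) (by linarith) (by linarith)
    (by linear_combination hw2)).lt r hr
  refine h.le.trans (le_of_eq ?_)
  ring
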